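/- Let $n\ge 1$, $T>0$, let $\Omega\subset\mathbb R^n$ be a bounded open set with locally Lipschitz boundary, and let $r\in\mathbb R$ with $r\ge 2$, $r>n$. Let $y_0\in W^{1,r}_0(\Omega)$ and let $f:[0,T]\times\Omega\times\mathbb R\to\mathbb R$ be measurable in $(t,x)$, continuous in $y$ for almost every $(t,x)$, and such that for every compact $K\subset\mathbb R$ there is $M_K\ge 0$ with $\sup_{y\in K}|f(t,x,y)|\le M_K$ for almost every $(t,x)$. Consider the problem $\partial_t y-\Delta_x y=f(t,x,y)$ in $(0,T]\times\Omega$, $y=0$ on $[0,T]\times\partial\Omega$, $y(0,\cdot)=y_0$. Let $\mathbf Y\subset\mathbb R$ and $\mathbf Z\subset\mathbb R\times\mathbb R^n$ be compact; write $z=(z_0,\bar z)$, $\bar z=(z_1,\dots,z_n)$, for the points of $\mathbf Z$. Here $C^1(\mathbf Y)$ is the set of (restrictions to $\mathbf Y$ of) $C^1$ functions $\beta$ on $\mathbb R$, taken together with their derivatives $\beta'$. Let $Q_T=[0,T]\times\overline\Omega$, with boundary $\partial Q_T=\partial Q_1\cup\partial Q_2\cup\partial Q_3$, $\partial Q_1=\{0\}\times\overline\Omega$,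 $\partial Q_2=\{T\}\times\overline\Omega$, $\partial Q_3=[0,T]\times\partial\Omega$, with surface measure $\sigma$ and outward unit normal $\eta=(\eta_0,\eta_1,\dots,\eta_n)$. **Occupation-measure identities.** A pair of finite nonnegative Borel measures $\hat\mu$ on $Q_T\times\mathbf Y\times\mathbf Z$ and $\hat\mu_\partial$ on $\partial Q_T\times\mathbf Y\times\mathbf Z$ (with $\hat\mu_{\partial,i}$ the restriction of $\hat\mu_\partial$ to $\partial Q_i\times\mathbf Y\times\mathbf Z$) satisfies the occupation-measure identities if for every $\phi(t,x,y)=\varphi(t)v(x)\beta(y)$ with $\varphi\in C^\infty([0,T])$, $v\in H^1(\Omega)$ (understood on $\partial\Omega$ through its trace), $\beta\in C^1(\mathbf Y)$: 1. $\int \big[\partial_t\phi+z_0\,\partial_y\phi\big]\,d\hat\mu-\int\phi\,\eta_0\,d\hat\mu_\partial=0$; 2. $\int \big[\partial_{x_j}\phi+z_j\,\partial_y\phi\big]\,d\hat\mu-\int\phi\,\eta_j\,d\hat\mu_\partial=0$ for $j=1,\dots,n$; 3. $\int \big[\phi\,(z_0-f)+\sum_{j=1}^n(\partial_{x_j}\phi+z_j\,\partial_y\phi)z_j\big]\,d\hat\mu-\sum_{j=1}^n\int\phi\,z_j\,\eta_j\,d\hat\mu_\partial=0$;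 4. $\int \big[\varphi z_0^2-\tfrac12\varphi'\|\bar z\|^2-\varphi z_0 f\big]\,d\hat\mu+\int\tfrac12\varphi\|\bar z\|^2\eta_0\,d\hat\mu_\partial=0$; 5. $\int\phi\,d\hat\mu_{\partial,1}=\int_\Omega\phi(0,x,y_0(x))\,dx$; 6. $\int\phi\,d\hat\mu_{\partial,3}=\int_{[0,T]\times\partial\Omega}\phi(t,x,0)\,d\sigma(t,x)$; 7. $\int\psi(t,x)\,d\hat\mu_{\partial,i}=\int_{\partial Q_i}\psi\,d\sigma$ for all $\psi\in C^\infty(Q_T)$ and $i\in\{1,2,3\}$. **Young measures and emv solutions.** A Young measure $\mu$ on $\mathbf Y\times\mathbf Z$ parametrized by $[0,T]\times\Omega$ is a map $(t,x)\mapsto\mu_{(t,x)}$ into the probability measures on $\mathbf Y\times\mathbf Z$ such that $(t,x)\mapsto\langle\mu_{(t,x)},g\rangle:=\int g\,d\mu_{(t,x)}$ is measurable for every bounded continuous $g$. It is an energy measure-valued (emv) solution of the above problem if * it has finite $r$-moments: $\int_0^T\!\int_\Omega\int\|(y,z)\|^r\,d\mu_{(t,x)}\,dx\,dt<\infty$;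 * for all $\beta\in C^1(\mathbf Y)$ and $\psi\in C^\infty_c((0,T)\times\Omega)$, $\int_0^T\!\int_\Omega\partial_t\psi\,\langle\mu_{(t,x)},\beta(y)\rangle=-\int_0^T\!\int_\Omega\psi\,\langle\mu_{(t,x)},z_0\beta'(y)\rangle$ and $\int_0^T\!\int_\Omega\nabla_x\psi\,\langle\mu_{(t,x)},\beta(y)\rangle=-\int_0^T\!\int_\Omega\psi\,\langle\mu_{(t,x)},\bar z\beta'(y)\rangle$; * with $m_1=\langle\mu_{(t,x)},y\rangle$, $m_2=\langle\mu_{(t,x)},y^2\rangle$, $s_1=\langle\mu_{(t,x)},f(t,x,y)\rangle$, $s_2=2\langle\mu_{(t,x)},yf(t,x,y)\rangle-2\langle\mu_{(t,x)},\|\bar z\|^2\rangle$, one has for $k=1,2$: $m_k\in W^{1,r}((0,T)\times\Omega)$; $\int_0^T\!\int_\Omega\varphi\,[v\,\partial_tm_k+\nabla v\cdot\nabla_xm_k-v\,s_k]\,dx\,dt=0$ for all $v\in H^1_0(\Omega)$ and $\varphi\in C_c^\infty((0,T))$; for almost every $t$, the continuous representative of $m_k(t,\cdot)$ on $\overline\Omega$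 vanishes on $\partial\Omega$; and the representative of $m_k$ in $C([0,T];L^r(\Omega))$ satisfies $m_k(0,\cdot)=y_0^k$ in $L^r(\Omega)$; * for all $\varphi\in C^\infty_c((0,T))$, $\int_0^T\!\int_\Omega\big[\varphi\langle\mu_{(t,x)},z_0^2\rangle-\varphi'\langle\mu_{(t,x)},\tfrac12\|\bar z\|^2\rangle-\varphi\langle\mu_{(t,x)},z_0f(t,x,y)\rangle\big]\,dx\,dt=0$. **Proposition.** Suppose that $(\hat\mu,\hat\mu_\partial)$ satisfies the occupation-measure identities. Then there is a Young measure $\mu$ on $\mathbf Y\times\mathbf Z$ parametrized by $[0,T]\times\Omega$ with $d\hat\mu(t,x,y,z)=d\mu_{(t,x)}(y,z)\,dx\,dt$ on $Q_T\times\mathbf Y\times\mathbf Z$, and every such Young measure is an emv solution of the above problem. -/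

import Mathlib

open MeasureTheory Set Filter Topology
open scoped ContDiff ENNReal NNReal

/-- The space `ℝⁿ` with its Euclidean norm. -/
abbrev Space (n : ℕ) := EuclideanSpace ℝ (Fin n)

/-- Time-space points `(t, x)`. The volume on this type is the Lebesgue measure `dt dx`. -/
abbrev TimeSpace (n : ℕ) := ℝ × Space n

/-- Values `(y, (z₀, z̄))` of the unknown, of its time derivative and of its space gradient. -/
abbrev Val (n : ℕ) := ℝ × (ℝ × Space n)

noncomputable section

/-! ### Domains with Lipschitz boundary, surface measure, outward normal -/

/-- Locally Lipschitz boundary: near each boundary point, and for a suitable unit vector `e` as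
vertical direction, `Ω` is the set of the points that lie strictly above the graph of a Lipschitz
function `γ` of the horizontal component `x - ⟪e, x⟫ e`. -/
def HasLipschitzBoundary {n : ℕ} (Ω : Set (Space n)) : Prop :=
  ∀ x₀ ∈ frontier Ω, ∃ (ρ : ℝ) (e : Space n) (γ : Space n → ℝ) (L : ℝ≥0),
    0 < ρ ∧ ‖e‖ = 1 ∧ LipschitzWith L γ ∧
      ∀ x ∈ Metric.ball x₀ ρ, x ∈ Ω ↔ γ (x - inner ℝ e x • e) < inner ℝ e x

/-- The surface measure of `∂Ω`: the `(n-1)`-dimensional Hausdorff measure, normalized so as to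
agree with Lebesgue measure on `(n-1)`-dimensional Euclidean spaces, restricted to `∂Ω`. -/
def surfaceMeasure {n : ℕ} (Ω : Set (Space n)) : Measure (Space n) :=
  (μHE[n - 1] : Measure (Space n)).restrict (frontier Ω)

/-- `ν` is the outward unit normal of `Ω` at the boundary point `x`: near `x`, outside of arbitrarily
thin cones around the tangent hyperplane, `Ω` fills the side `-ν` and its complement the
side `ν`. There is at most one such vector; for a Lipschitz boundary it exists almost everywhere
(wherever the function of which the boundary is the graph is differentiable). -/
def IsOutwardNormal {n : ℕ} (Ω : Set (Space n)) (x ν : Space n) : Prop :=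
  ‖ν‖ = 1 ∧ ∀ ε > 0, ∃ δ > 0, ∀ y : Space n, ‖y - x‖ < δ →
    (inner ℝ ν (y - x) < -(ε * ‖y - x‖) → y ∈ Ω) ∧
    (ε * ‖y - x‖ < inner ℝ ν (y - x) → y ∉ closure Ω)

open Classical in
/-- The outward unit normal field of `Ω` on `∂Ω` (zero at the exceptional points without normal). -/
def outwardNormal {n : ℕ} (Ω : Set (Space n)) (x : Space n) : Space n :=
  if h : ∃ ν, IsOutwardNormal Ω x ν then h.choose else 0

/-! ### The cylinder `Q_T = [0,T] × closure Ω` and its boundary -/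

/-- The closed cylinder `Q_T`. -/
def closedCylinder {n : ℕ} (T : ℝ) (Ω : Set (Space n)) : Set (TimeSpace n) :=
  Icc 0 T ×ˢ closure Ω

/-- The three pieces of the boundary of `Q_T`: bottom, top and lateral boundary. -/
def boundaryPiece {n : ℕ} (T : ℝ) (Ω : Set (Space n)) : Fin 3 → Set (TimeSpace n) :=
  ![{0} ×ˢ closure Ω, {T} ×ˢ closure Ω, Icc 0 T ×ˢ frontier Ω]

/-- The boundary of `Q_T`. -/
def cylinderBoundary {n : ℕ} (T : ℝ) (Ω : Set (Space n)) : Set (TimeSpace n) :=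
  ⋃ i, boundaryPiece T Ω i

/-- The surface measure on the three pieces of the boundary of `Q_T`: Lebesgue measure on the bottom
and on the top, `dt` times the surface measure of `∂Ω` on the lateral boundary. (The pieces overlap
in a set of surface measure zero.) -/
def boundarySurface {n : ℕ} (T : ℝ) (Ω : Set (Space n)) : Fin 3 → Measure (TimeSpace n) :=
  ![(Measure.dirac 0).prod (volume.restrict (closure Ω)),
    (Measure.dirac T).prod (volume.restrict (closure Ω)),
    (volume.restrict (Icc 0 T)).prod (surfaceMeasure Ω)]

/-- Time component `η₀` of the outward unit normal on the boundary of `Q_T`. -/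
def normalTime {n : ℕ} (T : ℝ) (p : TimeSpace n) : ℝ :=
  if p.1 = 0 then -1 else if p.1 = T then 1 else 0

/-- Space components `(η₁, …, ηₙ)` of the outward unit normal on the boundary of `Q_T`. -/
def normalSpace {n : ℕ} (T : ℝ) (Ω : Set (Space n)) (p : TimeSpace n) : Space n :=
  if p.1 = 0 ∨ p.1 = T then 0 else outwardNormal Ω p.2

/-! ### Sobolev spaces -/

/-- `ψ ∈ C_c^∞(U)`. -/
def IsTestFunction {F : Type*} [NormedAddCommGroup F] [NormedSpace ℝ F] (U : Set F) (ψ : F → ℝ) :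
    Prop :=
  ContDiff ℝ ∞ ψ ∧ HasCompactSupport ψ ∧ tsupport ψ ⊆ U

/-- `u ∈ W^{1,p}(Ω)` with weak gradient `g`. -/
def MemW1 {n : ℕ} (Ω : Set (Space n)) (p : ℝ≥0∞) (u : Space n → ℝ) (g : Space n → Space n) : Prop :=
  MemLp u p (volume.restrict Ω) ∧ MemLp g p (volume.restrict Ω) ∧
    ∀ ψ, IsTestFunction Ω ψ →
      (∫ x in Ω, u x • gradient ψ x) = -(∫ x in Ω, ψ x • g x)

/-- `u ∈ W₀^{1,p}(Ω)`, the closure of `C_c^∞(Ω)` in `W^{1,p}(Ω)`; `g` is the weak gradient. -/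
def MemW10 {n : ℕ} (Ω : Set (Space n)) (p : ℝ≥0∞) (u : Space n → ℝ) (g : Space n → Space n) :
    Prop :=
  MemW1 Ω p u g ∧ ∃ ψ : ℕ → Space n → ℝ, (∀ k, IsTestFunction Ω (ψ k)) ∧
    Tendsto (fun k => eLpNorm (fun x => ψ k x - u x) p (volume.restrict Ω)) atTop (𝓝 0) ∧
    Tendsto (fun k => eLpNorm (fun x => gradient (ψ k) x - g x) p (volume.restrict Ω)) atTop (𝓝 0)

/-- `v` represents an element of `H¹(Ω)`, with weak gradient `g`, on the closure of `Ω`: its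
restriction to `Ω` represents the element of `H¹(Ω)` and its restriction to `∂Ω` represents the trace
of that element, i.e. the `L²(∂Ω)`-limit of the boundary values of smooth functions which converge
to it in `H¹(Ω)`. -/
def MemH1WithTrace {n : ℕ} (Ω : Set (Space n)) (v : Space n → ℝ) (g : Space n → Space n) : Prop :=
  MemW1 Ω 2 v g ∧ AEStronglyMeasurable v (surfaceMeasure Ω) ∧
    ∃ u : ℕ → Space n → ℝ, (∀ k, ContDiff ℝ ∞ (u k)) ∧
      Tendsto (fun k => eLpNorm (fun x => u k x - v x) 2 (volume.restrict Ω)) atTop (𝓝 0) ∧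
      Tendsto (fun k => eLpNorm (fun x => gradient (u k) x - g x) 2 (volume.restrict Ω))
        atTop (𝓝 0) ∧
      Tendsto (fun k => eLpNorm (fun x => u k x - v x) 2 (surfaceMeasure Ω)) atTop (𝓝 0)

/-- Classical time derivative `∂ₜψ` of a function of `(t, x)`. -/
def timeDeriv {n : ℕ} (ψ : TimeSpace n → ℝ) (p : TimeSpace n) : ℝ :=
  deriv (fun s => ψ (s, p.2)) p.1

/-- Classical space gradient `∇ₓψ` of a function of `(t, x)`. -/
def spaceGrad {n : ℕ} (ψ : TimeSpace n → ℝ) (p : TimeSpace n) : Space n :=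
  gradient (fun x => ψ (p.1, x)) p.2

/-- `m ∈ W^{1,p}((0,T) × Ω)` with weak time derivative `mt` and weak space gradient `mx`. -/
def MemW1TimeSpace {n : ℕ} (T : ℝ) (Ω : Set (Space n)) (p : ℝ≥0∞) (m mt : TimeSpace n → ℝ)
    (mx : TimeSpace n → Space n) : Prop :=
  MemLp m p (volume.restrict (Ioo 0 T ×ˢ Ω)) ∧ MemLp mt p (volume.restrict (Ioo 0 T ×ˢ Ω)) ∧
    MemLp mx p (volume.restrict (Ioo 0 T ×ˢ Ω)) ∧
    ∀ ψ, IsTestFunction (Ioo 0 T ×ˢ Ω) ψ →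
      (∫ q in Ioo 0 T ×ˢ Ω, timeDeriv ψ q * m q) = -(∫ q in Ioo 0 T ×ˢ Ω, ψ q * mt q) ∧
      (∫ q in Ioo 0 T ×ˢ Ω, m q • spaceGrad ψ q) = -(∫ q in Ioo 0 T ×ˢ Ω, ψ q • mx q)

/-! ### The reaction term -/

/-- The reaction term `f(t,x,y)`: measurable in `(t,x)`, for almost every `(t,x)` continuous in `y`,
essentially bounded in `(t,x)` uniformly for `y` in a compact set. -/
structure IsReactionTerm {n : ℕ} (T : ℝ) (Ω : Set (Space n)) (f : ℝ → Space n → ℝ → ℝ) :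
    Prop where
  measurable : ∀ y, AEStronglyMeasurable (fun p : TimeSpace n => f p.1 p.2 y)
    (volume.restrict (Icc 0 T ×ˢ Ω))
  continuous : ∀ᵐ p : TimeSpace n ∂volume.restrict (Icc 0 T ×ˢ Ω), Continuous (f p.1 p.2)
  bounded : ∀ K : Set ℝ, IsCompact K → ∃ M : ℝ, 0 ≤ M ∧
    ∀ᵐ p : TimeSpace n ∂volume.restrict (Icc 0 T ×ˢ Ω), ∀ y ∈ K, |f p.1 p.2 y| ≤ M

/-! ### Young measures -/

/-- `μ` is a Young measure on `K` parametrized by `[0,T] × Ω`. -/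
structure IsYoungMeasure {n : ℕ} (T : ℝ) (Ω : Set (Space n)) (K : Set (Val n))
    (μ : TimeSpace n → Measure (Val n)) : Prop where
  prob : ∀ p ∈ Icc 0 T ×ˢ Ω, IsProbabilityMeasure (μ p)
  supp : ∀ p ∈ Icc 0 T ×ˢ Ω, μ p Kᶜ = 0
  measurable : ∀ g : Val n → ℝ, ContinuousOn g K → (∃ C, ∀ ξ ∈ K, |g ξ| ≤ C) →
    AEStronglyMeasurable (fun p => ∫ ξ in K, g ξ ∂μ p) (volume.restrict (Icc 0 T ×ˢ Ω))

/-- Finite `r`-moments: `(t,x) ↦ ∫ ‖ξ‖^r dμ_{(t,x)}(ξ)` is in `L¹((0,T) × Ω)`. -/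
def HasFiniteMoments {n : ℕ} (T : ℝ) (Ω : Set (Space n)) (r : ℝ)
    (μ : TimeSpace n → Measure (Val n)) : Prop :=
  let N : TimeSpace n → ℝ≥0∞ := fun p =>
    ∫⁻ ξ, ENNReal.ofReal (√(ξ.1 ^ 2 + ξ.2.1 ^ 2 + ‖ξ.2.2‖ ^ 2) ^ r) ∂μ p
  AEMeasurable N (volume.restrict (Ioo 0 T ×ˢ Ω)) ∧ (∫⁻ p in Ioo 0 T ×ˢ Ω, N p) < ⊤

/-- Integration-by-parts formula for Young measures, for all `β` of class `C¹`. -/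
def SatisfiesIBP {n : ℕ} (T : ℝ) (Ω : Set (Space n)) (μ : TimeSpace n → Measure (Val n)) : Prop :=
  ∀ β : ℝ → ℝ, ContDiff ℝ 1 β → ∀ ψ : TimeSpace n → ℝ, IsTestFunction (Ioo 0 T ×ˢ Ω) ψ →
    (∫ p in Ioo 0 T ×ˢ Ω, timeDeriv ψ p * (∫ ξ, β ξ.1 ∂μ p))
      = -(∫ p in Ioo 0 T ×ˢ Ω, ψ p * (∫ ξ, ξ.2.1 * deriv β ξ.1 ∂μ p)) ∧
    (∫ p in Ioo 0 T ×ˢ Ω, (∫ ξ, β ξ.1 ∂μ p) • spaceGrad ψ p)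
      = -(∫ p in Ioo 0 T ×ˢ Ω, ψ p • (∫ ξ, deriv β ξ.1 • ξ.2.2 ∂μ p))

/-- The moment `m` is a weak solution of `∂ₜ m - Δ m = s` with zero boundary values and initial value
`m₀`. Here `m` has a weak time derivative and gradient in `L^r`; the boundary condition
is imposed on the continuous representative of `m(t, ·)` on the closure of `Ω` for almost every `t`,
the initial condition on the representative of `m` in `C([0,T]; L^r(Ω))`. -/
def SolvesMomentEquation {n : ℕ} (T : ℝ) (Ω : Set (Space n)) (r : ℝ)
    (m s : TimeSpace n → ℝ) (m₀ : Space n → ℝ) : Prop :=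
  (∃ (mt : TimeSpace n → ℝ) (mx : TimeSpace n → Space n),
    MemW1TimeSpace T Ω (ENNReal.ofReal r) m mt mx ∧
    ∀ v g, MemW10 Ω 2 v g → ∀ φ : ℝ → ℝ, IsTestFunction (Ioo 0 T) φ →
      (∫ p in Ioo 0 T ×ˢ Ω,
        φ p.1 * (v p.2 * mt p + inner ℝ (g p.2) (mx p) - v p.2 * s p)) = 0) ∧
  (∀ᵐ t ∂volume.restrict (Icc 0 T), ∃ c : Space n → ℝ, ContinuousOn c (closure Ω) ∧
    (∀ᵐ x ∂volume.restrict Ω, c x = m (t, x)) ∧ ∀ x ∈ frontier Ω, c x = 0) ∧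
  (∃ M : ℝ → Space n → ℝ,
    (∀ t ∈ Icc 0 T, MemLp (M t) (ENNReal.ofReal r) (volume.restrict Ω)) ∧
    (∀ t ∈ Icc 0 T, Tendsto
      (fun t' => eLpNorm (fun x => M t' x - M t x) (ENNReal.ofReal r) (volume.restrict Ω))
      (𝓝[Icc 0 T] t) (𝓝 0)) ∧
    (∀ᵐ t ∂volume.restrict (Icc 0 T), ∀ᵐ x ∂volume.restrict Ω, M t x = m (t, x)) ∧
    ∀ᵐ x ∂volume.restrict Ω, M 0 x = m₀ x)

/-- Energy measure-valued solutions with values in `Y × Z`, where `Z` is a set of values of the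
time-space gradient (`Z = univ` if it is not restricted). -/
structure IsEmvSolution {n : ℕ} (T : ℝ) (Ω : Set (Space n)) (r : ℝ) (f : ℝ → Space n → ℝ → ℝ)
    (y₀ : Space n → ℝ) (Y : Set ℝ) (Z : Set (ℝ × Space n)) (μ : TimeSpace n → Measure (Val n)) :
    Prop where
  young : IsYoungMeasure T Ω (Y ×ˢ Z) μ
  moments : HasFiniteMoments T Ω r μ
  ibp : SatisfiesIBP T Ω μ
  first_moment : SolvesMomentEquation T Ω r (fun p => ∫ ξ, ξ.1 ∂μ p)
    (fun p => ∫ ξ, f p.1 p.2 ξ.1 ∂μ p) y₀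
  second_moment : SolvesMomentEquation T Ω r (fun p => ∫ ξ, ξ.1 ^ 2 ∂μ p)
    (fun p => 2 * (∫ ξ, ξ.1 * f p.1 p.2 ξ.1 ∂μ p) - 2 * (∫ ξ, ‖ξ.2.2‖ ^ 2 ∂μ p)) (fun x => y₀ x ^ 2)
  dissipation : ∀ φ : ℝ → ℝ, IsTestFunction (Ioo 0 T) φ →
    (∫ p in Ioo 0 T ×ˢ Ω, (φ p.1 * (∫ ξ, ξ.2.1 ^ 2 ∂μ p)
      - deriv φ p.1 * (∫ ξ, (1 / 2 : ℝ) * ‖ξ.2.2‖ ^ 2 ∂μ p)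
      - φ p.1 * (∫ ξ, ξ.2.1 * f p.1 p.2 ξ.1 ∂μ p))) = 0

/-! ### Occupation measures -/

/-- The occupation-measure identities for a pair of finite measures on `Q_T × Y × Z` and on
`∂Q_T × Y × Z`. The test functions are `φ(t) v(x) β(y)` with `φ` smooth, `v ∈ H¹(Ω)` (represented
on the closure of `Ω` by means of its trace, with weak gradient `g`) and `β` of class `C¹`.
A point of `Q_T × Y × Z` is `q = (p, ξ)` with `p = (t, x)` and `ξ = (y, (z₀, z̄))`. -/
structure OccupationIdentities {n : ℕ} (T : ℝ) (Ω : Set (Space n)) (f : ℝ → Space n → ℝ → ℝ)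
    (y₀ : Space n → ℝ) (μ μb : Measure (TimeSpace n × Val n)) : Prop where
  ibp_time : ∀ (φ : ℝ → ℝ) (v : Space n → ℝ) (g : Space n → Space n) (β : ℝ → ℝ),
    ContDiff ℝ ∞ φ → MemH1WithTrace Ω v g → ContDiff ℝ 1 β →
    (∫ q, (deriv φ q.1.1 * v q.1.2 * β q.2.1
        + q.2.2.1 * (φ q.1.1 * v q.1.2 * deriv β q.2.1)) ∂μ)
      - (∫ q, φ q.1.1 * v q.1.2 * β q.2.1 * normalTime T q.1 ∂μb) = 0
  ibp_space : ∀ (φ : ℝ → ℝ) (v : Space n → ℝ) (g : Space n → Space n) (β : ℝ → ℝ),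
    ContDiff ℝ ∞ φ → MemH1WithTrace Ω v g → ContDiff ℝ 1 β → ∀ j : Fin n,
    (∫ q, (φ q.1.1 * g q.1.2 j * β q.2.1
        + q.2.2.2 j * (φ q.1.1 * v q.1.2 * deriv β q.2.1)) ∂μ)
      - (∫ q, φ q.1.1 * v q.1.2 * β q.2.1 * normalSpace T Ω q.1 j ∂μb) = 0
  weak_form : ∀ (φ : ℝ → ℝ) (v : Space n → ℝ) (g : Space n → Space n) (β : ℝ → ℝ),
    ContDiff ℝ ∞ φ → MemH1WithTrace Ω v g → ContDiff ℝ 1 β →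
    (∫ q, (φ q.1.1 * v q.1.2 * β q.2.1 * (q.2.2.1 - f q.1.1 q.1.2 q.2.1)
        + (∑ j, (φ q.1.1 * g q.1.2 j * β q.2.1
          + q.2.2.2 j * (φ q.1.1 * v q.1.2 * deriv β q.2.1)) * q.2.2.2 j)) ∂μ)
      - (∑ j, (∫ q, φ q.1.1 * v q.1.2 * β q.2.1 * q.2.2.2 j * normalSpace T Ω q.1 j ∂μb)) = 0
  dissipation : ∀ φ : ℝ → ℝ, ContDiff ℝ ∞ φ →
    (∫ q, (φ q.1.1 * q.2.2.1 ^ 2 - (1 / 2 : ℝ) * deriv φ q.1.1 * ‖q.2.2.2‖ ^ 2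
        - φ q.1.1 * q.2.2.1 * f q.1.1 q.1.2 q.2.1) ∂μ)
      + (∫ q, (1 / 2 : ℝ) * φ q.1.1 * ‖q.2.2.2‖ ^ 2 * normalTime T q.1 ∂μb) = 0
  initial : ∀ (φ : ℝ → ℝ) (v : Space n → ℝ) (g : Space n → Space n) (β : ℝ → ℝ),
    ContDiff ℝ ∞ φ → MemH1WithTrace Ω v g → ContDiff ℝ 1 β →
    (∫ q in boundaryPiece T Ω 0 ×ˢ univ, φ q.1.1 * v q.1.2 * β q.2.1 ∂μb)
      = (∫ x in Ω, φ 0 * v x * β (y₀ x))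
  boundary : ∀ (φ : ℝ → ℝ) (v : Space n → ℝ) (g : Space n → Space n) (β : ℝ → ℝ),
    ContDiff ℝ ∞ φ → MemH1WithTrace Ω v g → ContDiff ℝ 1 β →
    (∫ q in boundaryPiece T Ω 2 ×ˢ univ, φ q.1.1 * v q.1.2 * β q.2.1 ∂μb)
      = (∫ p, φ p.1 * v p.2 * β 0 ∂boundarySurface T Ω 2)
  normalization : ∀ ψ : TimeSpace n → ℝ, ContDiff ℝ ∞ ψ → ∀ i,
    (∫ q in boundaryPiece T Ω i ×ˢ univ, ψ q.1 ∂μb) = (∫ p, ψ p ∂boundarySurface T Ω i)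

/-- The disintegration `dμ̂(t,x,y,z) = dμ_{(t,x)}(y,z) dx dt` on `Q_T`. -/
def IsDisintegration {n : ℕ} (T : ℝ) (Ω : Set (Space n)) (μhat : Measure (TimeSpace n × Val n))
    (μ : TimeSpace n → Measure (Val n)) : Prop :=
  ∀ F : TimeSpace n × Val n → ℝ≥0∞, Measurable F →
    (∫⁻ q, F q ∂μhat) = (∫⁻ p in closedCylinder T Ω, (∫⁻ ξ, F (p, ξ) ∂μ p))

end

/-!
The time identity with `β = 1`, together with the normalization of the boundary measure on top and
bottom, shows that the `(t, x)`-marginal of `μ̂` is the Lebesgue measure on the cylinder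
(`IsOccupationPair.map_fst`). Hence `μ̂` disintegrates into a Young measure, which is unique up to
null sets (`IsOccupationPair.exists_youngMeasure`, `IsOccupationPair.exists_kernel_ae_eq`), and
integrals against `μ̂` become integrals of moments.

The integration-by-parts identities are given for products `φ(t) v(x) β(y)`. By the Stone-Weierstrass
theorem, applied to the derivative of a test function `ψ(t, x)` and followed by integration along
lines, they hold for `ψ(t, x) β(y)` (`ibpPairing_eq_zero`). This is the integration-by-parts formula
of emv solutions. The weak form of the moment equations comes from the third identity, tested with the
functions `1` and `2y` of `y` (the derivatives of `y` and `y²`), since functions of `W₀^{1,2}` extended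
by zero have zero trace.

The boundary and initial values rest on the compactness of the set of gradients. The boundary identity
with `β(y) = y²` shows that `y = 0` almost everywhere on the lateral boundary. Thus, if `β(0) = 0`, the
space identities have no boundary terms, and the moment `⟨μ, β(y)⟩`, extended by zero to
`(0, T) × ℝⁿ`, has bounded weak derivatives there. By mollification it coincides almost everywhere
with a Lipschitz function (`exists_lipschitzWith_ae_eq`), which vanishes outside of `Ω` and therefore
on `∂Ω`, as boundary points of a Lipschitz domain are limits of exterior points. This function is the
continuous representative that both conditions ask for. Its value at `t = 0` is found from the
time identity with functions of `t` that concentrate at `t = 0`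
(`IsOccupationPair.initial_value`).
-/

/-! ### Lipschitz boundaries -/

section Geometry

variable {n : ℕ} {Ω : Set (Space n)}

/-- Local description of the boundary: near each boundary point there are a direction `e` and a
continuous function `k` with `k (x + t e) = k x + t`, such that `Ω` is locally the set `0 < k`.
(`k x` is the height of `x` over the graph.) -/
lemma HasLipschitzBoundary.exists_height (hΩ : HasLipschitzBoundary Ω) {x₀ : Space n}
    (hx₀ : x₀ ∈ frontier Ω) : ∃ (ρ : ℝ) (e : Space n) (k : Space n → ℝ), 0 < ρ ∧ ‖e‖ = 1 ∧
      Continuous k ∧ (∀ x t, k (x + t • e) = k x + t) ∧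
      ∀ x ∈ Metric.ball x₀ ρ, x ∈ Ω ↔ 0 < k x := by
  obtain ⟨ρ, e, γ, L, hρ, he, hγ, h⟩ := hΩ x₀ hx₀
  refine ⟨ρ, e, fun x => inner ℝ e x - γ (x - inner ℝ e x • e), hρ, he, ?_, ?_, ?_⟩
  · have := hγ.continuous
    fun_prop
  · intro x t
    have h1 : inner ℝ e (x + t • e) = inner ℝ e x + t := by
      rw [inner_add_right, inner_smul_right, real_inner_self_eq_norm_sq, he]; ring
    have h2 : x + t • e - inner ℝ e (x + t • e) • e = x - inner ℝ e x • e := by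
      rw [h1, add_smul]; abel
    simp only [h2]
    rw [h1]; ring
  · intro x hx
    rw [h x hx, sub_pos]

lemma height_eq_zero_of_mem_frontier (hΩo : IsOpen Ω) {x₀ : Space n} {ρ : ℝ} {k : Space n → ℝ}
    (hk : Continuous k) (h : ∀ x ∈ Metric.ball x₀ ρ, x ∈ Ω ↔ 0 < k x) {x : Space n}
    (hx : x ∈ frontier Ω) (hxb : x ∈ Metric.ball x₀ ρ) : k x = 0 := by
  have hb : Metric.ball x₀ ρ ∈ 𝓝 x := Metric.isOpen_ball.mem_nhds hxb
  rcases lt_trichotomy (k x) 0 with hlt | heq | hgt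
  · have : Ωᶜ ∈ 𝓝 x := by
      filter_upwards [hb, hk.continuousAt.eventually_lt continuousAt_const hlt] with y hy hky
      exact fun hyΩ => absurd ((h y hy).1 hyΩ) (not_lt.2 hky.le)
    exact absurd hx.1 (by rw [← mem_compl_iff, ← interior_compl]; exact mem_interior_iff_mem_nhds.2 this)
  · exact heq
  · exact absurd hx (by rw [hΩo.frontier_eq]; exact fun h' => h'.2 ((h x hxb).2 hgt))

/-- The boundary is a null set: locally it is disjoint from its translates in the vertical
direction. -/
lemma HasLipschitzBoundary.volume_frontier (hΩ : HasLipschitzBoundary Ω) (hΩo : IsOpen Ω) :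
    volume (frontier Ω) = 0 := by
  refine measure_null_of_locally_null _ fun x₀ hx₀ => ?_
  obtain ⟨ρ, e, k, hρ, he, hk, hke, h⟩ := hΩ.exists_height hx₀
  refine ⟨frontier Ω ∩ Metric.ball x₀ ρ, inter_mem self_mem_nhdsWithin
    (mem_nhdsWithin_of_mem_nhds (Metric.ball_mem_nhds _ hρ)), ?_⟩
  have hsub : frontier Ω ∩ Metric.ball x₀ ρ ⊆ k ⁻¹' {0} := fun x hx =>
    height_eq_zero_of_mem_frontier hΩo hk h hx.1 hx.2
  refine measure_mono_null hsub ?_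
  refine Measure.addHaar_eq_zero_of_disjoint_translates volume
    (fun j : ℕ => (1 / ((j : ℝ) + 1)) • e) ?_ ?_ (isClosed_singleton.preimage hk).measurableSet
  · rw [isBounded_iff_forall_norm_le]
    refine ⟨1, ?_⟩
    rintro _ ⟨j, rfl⟩
    rw [norm_smul, he, mul_one, Real.norm_of_nonneg (by positivity)]
    exact (div_le_one (by positivity)).2 (by linarith [(Nat.cast_nonneg j : (0 : ℝ) ≤ j)])
  · intro i j hij
    refine Set.disjoint_left.2 ?_
    simp only [singleton_add, mem_image]
    rintro _ ⟨a, ha, rfl⟩ ⟨b, hb, hab⟩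
    have h1 := hke a (1 / ((i : ℝ) + 1))
    have h2 := hke b (1 / ((j : ℝ) + 1))
    rw [add_comm, hab, add_comm, h1, show k a = 0 from ha, show k b = 0 from hb, zero_add, zero_add] at h2
    rw [one_div, one_div, inv_inj] at h2
    exact hij (by exact_mod_cast add_right_cancel h2)

/-- Boundary points are limits of exterior points. -/
lemma HasLipschitzBoundary.frontier_subset (hΩ : HasLipschitzBoundary Ω) (hΩo : IsOpen Ω) :
    frontier Ω ⊆ closure (closure Ω)ᶜ := by
  intro x₀ hx₀
  obtain ⟨ρ, e, k, hρ, he, hk, hke, h⟩ := hΩ.exists_height hx₀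
  have h0 := height_eq_zero_of_mem_frontier hΩo hk h hx₀ (Metric.mem_ball_self hρ)
  have hlim : Tendsto (fun t : ℝ => x₀ + t • e) (𝓝[<] 0) (𝓝 x₀) := by
    have : Continuous fun t : ℝ => x₀ + t • e := by fun_prop
    simpa using (this.tendsto 0).mono_left nhdsWithin_le_nhds
  refine mem_closure_of_tendsto hlim ?_
  filter_upwards [self_mem_nhdsWithin, hlim (Metric.ball_mem_nhds x₀ hρ)] with t ht hb hcl
  have hneg : k (x₀ + t • e) < 0 := by rw [hke, h0, zero_add]; exact ht
  have hopen : IsOpen (Metric.ball x₀ ρ ∩ {x | k x < 0}) :=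
    Metric.isOpen_ball.inter (isOpen_lt hk continuous_const)
  obtain ⟨y, hy, hyΩ⟩ := mem_closure_iff.1 hcl _ hopen ⟨hb, hneg⟩
  exact absurd ((h y hy.1).1 hyΩ) (not_lt.2 (le_of_lt hy.2))

end Geometry

/-! ### Approximation by products -/

section Density

variable {n : ℕ}

/-- The functions `φ(t) w₁(x₁) ⋯ wₙ(xₙ)` with smooth factors of one variable. -/
def productFunctions (n : ℕ) : Set C(TimeSpace n, ℝ) :=
  {F | ∃ (φ : ℝ → ℝ) (w : Fin n → ℝ → ℝ), ContDiff ℝ ∞ φ ∧ (∀ l, ContDiff ℝ ∞ (w l)) ∧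
    ∀ p, F p = φ p.1 * ∏ l, w l (p.2 l)}

/-- The products of functions of one variable span a subalgebra. -/
lemma adjoin_productFunctions :
    Subalgebra.toSubmodule (Algebra.adjoin ℝ (productFunctions n)) =
      Submodule.span ℝ (productFunctions n) := by
  let M : Submonoid C(TimeSpace n, ℝ) :=
    { carrier := productFunctions n
      one_mem' := ⟨fun _ => 1, fun _ _ => 1, contDiff_const, fun _ => contDiff_const, by simp⟩
      mul_mem' := by
        rintro F G ⟨φ, w, hφ, hw, hF⟩ ⟨φ', w', hφ', hw', hG⟩
        refine ⟨fun t => φ t * φ' t, fun l s => w l s * w' l s, hφ.mul hφ',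
          fun l => (hw l).mul (hw' l), fun p => ?_⟩
        rw [ContinuousMap.mul_apply, hF, hG, Finset.prod_mul_distrib]; ring }
  have hM : Submonoid.closure (productFunctions n) = M :=
    Submonoid.closure_eq M
  rw [Algebra.adjoin_eq_span, hM]
  rfl

/-- By the Stone-Weierstrass theorem, continuous functions of `(t, x)` are uniform limits on compact
sets of linear combinations of products of smooth functions of one variable. -/
lemma exists_mem_span_productFunctions_near (F : C(TimeSpace n, ℝ)) {K : Set (TimeSpace n)}
    (hK : IsCompact K) {ε : ℝ} (hε : 0 < ε) :
    ∃ P ∈ Submodule.span ℝ (productFunctions n), ∀ p ∈ K, |P p - F p| < ε := by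
  have hsep : (Algebra.adjoin ℝ (productFunctions n)).SeparatesPoints := by
    intro p q hpq
    by_cases h1 : p.1 = q.1
    · have h2 : p.2 ≠ q.2 := fun h => hpq (Prod.ext h1 h)
      obtain ⟨j, hj⟩ : ∃ j, p.2 j ≠ q.2 j := by
        by_contra! h
        exact h2 (PiLp.ext h)
      let G : C(TimeSpace n, ℝ) := ⟨fun p => p.2 j, by fun_prop⟩
      refine ⟨G, ⟨G, Algebra.subset_adjoin ⟨fun _ => 1, fun l s => if l = j then s else 1,
        contDiff_const, fun l => ?_, fun p => ?_⟩, rfl⟩, hj⟩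
      · by_cases hl : l = j
        · simp only [hl, if_true]; exact contDiff_id
        · simpa [hl] using contDiff_const
      · simp [G]
    · let G : C(TimeSpace n, ℝ) := ⟨fun p => p.1, by fun_prop⟩
      exact ⟨G, ⟨G, Algebra.subset_adjoin ⟨fun t => t, fun _ _ => 1, contDiff_id,
        fun _ => contDiff_const, by simp [G]⟩, rfl⟩, h1⟩
  obtain ⟨P, hP, hPK⟩ :=
    ContinuousMap.exists_mem_subalgebra_near_continuous_of_isCompact_of_separatesPoints hsep F hK hε
  refine ⟨P, ?_, hPK⟩
  rw [← adjoin_productFunctions]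
  exact hP

variable {V : Type*} [MeasurableSpace V]

/-- The bilinear pairing `∫ (F a + P b) dμ - ∫ P c dν` of functions `F`, `P` of `(t, x)`; with `F` a
derivative of `P` this is the shape of an integration-by-parts formula. -/
noncomputable def ibpPairing (μ ν : Measure (TimeSpace n × V)) (a b c : TimeSpace n × V → ℝ)
    (F P : TimeSpace n → ℝ) : ℝ :=
  (∫ q, (F q.1 * a q + P q.1 * b q) ∂μ) - ∫ q, P q.1 * c q ∂ν

lemma integrable_mul_of_bounded {μ : Measure (TimeSpace n × V)} [IsFiniteMeasure μ]
    {K : Set (TimeSpace n)} (hK : IsCompact K) (hμK : ∀ᵐ q ∂μ, q.1 ∈ K)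
    {a : TimeSpace n × V → ℝ} (ha : AEStronglyMeasurable a μ) {A : ℝ} (hA : ∀ᵐ q ∂μ, |a q| ≤ A)
    {F : TimeSpace n → ℝ} (hF : Continuous F) : Integrable (fun q => F q.1 * a q) μ := by
  obtain ⟨B, hB⟩ := hK.exists_bound_of_continuousOn hF.continuousOn
  refine Integrable.of_bound ((hF.measurable.comp measurable_fst).aestronglyMeasurable.mul ha)
    (B * A) ?_
  filter_upwards [hμK, hA] with q h1 h2
  rw [norm_mul]
  exact mul_le_mul (hB _ h1) h2 (norm_nonneg _) ((norm_nonneg _).trans (hB _ h1))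

/-- An integration-by-parts formula in the direction `e` that holds for all products of functions of
one variable holds for all test functions. The hypothesis `h` provides, for each product `F`, an
antiderivative `P` in the direction `e` that vanishes on the hyperplane `ℓ = -R`. -/
lemma ibpPairing_eq_zero {μ ν : Measure (TimeSpace n × V)} [IsFiniteMeasure μ] [IsFiniteMeasure ν]
    {K : Set (TimeSpace n)} (hK : IsCompact K) (hμK : ∀ᵐ q ∂μ, q.1 ∈ K) (hνK : ∀ᵐ q ∂ν, q.1 ∈ K)
    {a b c : TimeSpace n × V → ℝ} (ha : AEStronglyMeasurable a μ) (hb : AEStronglyMeasurable b μ)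
    (hc : AEStronglyMeasurable c ν) {A : ℝ} (hA : ∀ᵐ q ∂μ, |a q| ≤ A) (hB : ∀ᵐ q ∂μ, |b q| ≤ A)
    (hC : ∀ᵐ q ∂ν, |c q| ≤ A) {e : TimeSpace n} {ℓ : TimeSpace n →L[ℝ] ℝ} (hℓ : ℓ e = 1)
    (h : ∀ R : ℝ, ∀ F ∈ productFunctions n, ∃ P : TimeSpace n → ℝ, Continuous P ∧
      (∀ p, HasDerivAt (fun s : ℝ => P (p + s • e)) (F p) 0) ∧ (∀ p, ℓ p = -R → P p = 0) ∧
      ibpPairing μ ν a b c F P = 0)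
    {ψ : TimeSpace n → ℝ} (hψ : ContDiff ℝ ∞ ψ) (hψc : HasCompactSupport ψ) :
    ibpPairing μ ν a b c (fun p => fderiv ℝ ψ p e) ψ = 0 := by
  have hψd : Differentiable ℝ ψ := hψ.differentiable (by simp)
  have hψ' : Continuous fun p => fderiv ℝ ψ p e :=
    (hψ.continuous_fderiv (by simp)).clm_apply continuous_const
  obtain ⟨R, hR⟩ : ∃ R : ℝ, ∀ p, ℓ p = -R → ψ p = 0 := by
    obtain ⟨B, hB⟩ := hψc.isCompact.exists_bound_of_continuousOn ℓ.continuous.continuousOn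
    refine ⟨B + 1, fun p hp => ?_⟩
    by_contra hne
    have := hB p (subset_tsupport _ hne)
    rw [hp, norm_neg, Real.norm_eq_abs] at this
    linarith [le_abs_self (B + 1)]
  have hspan : ∀ F ∈ Submodule.span ℝ (productFunctions n), ∃ P : TimeSpace n → ℝ, Continuous P ∧
      (∀ p, HasDerivAt (fun s : ℝ => P (p + s • e)) (F p) 0) ∧ (∀ p, ℓ p = -R → P p = 0) ∧
      ibpPairing μ ν a b c F P = 0 := by
    intro F hF
    induction hF using Submodule.span_induction with
    | mem F hF => exact h R F hF
    | zero =>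
      exact ⟨fun _ => 0, continuous_const, fun p => by simpa using hasDerivAt_const _ _,
        fun _ _ => rfl, by simp [ibpPairing]⟩
    | add F G _ _ hF hG =>
      obtain ⟨P, hP, hPd, hP0, hPL⟩ := hF
      obtain ⟨Q, hQ, hQd, hQ0, hQL⟩ := hG
      refine ⟨fun p => P p + Q p, hP.add hQ, fun p => (hPd p).add (hQd p),
        fun p hp => by simp [hP0 p hp, hQ0 p hp], ?_⟩
      have i1 := (integrable_mul_of_bounded hK hμK ha hA F.continuous).add
        (integrable_mul_of_bounded hK hμK hb hB hP)
      have i2 := (integrable_mul_of_bounded hK hμK ha hA G.continuous).add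
        (integrable_mul_of_bounded hK hμK hb hB hQ)
      have i3 := integrable_mul_of_bounded hK hνK hc hC hP
      have i4 := integrable_mul_of_bounded hK hνK hc hC hQ
      have e1 := integral_add i1 i2
      have e2 := integral_add i3 i4
      rw [show (0 : ℝ) = ibpPairing μ ν a b c F P + ibpPairing μ ν a b c G Q by
        rw [hPL, hQL, add_zero]]
      simp only [ibpPairing, ContinuousMap.add_apply, Pi.add_apply] at e1 e2 ⊢
      rw [sub_add_sub_comm, ← e1, ← e2]
      congr 1 <;> refine integral_congr_ae (ae_of_all _ fun q => ?_) <;> simp only <;> ring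
    | smul k F _ hF =>
      obtain ⟨P, hP, hPd, hP0, hPL⟩ := hF
      refine ⟨fun p => k * P p, hP.const_mul k, fun p => (hPd p).const_mul k,
        fun p hp => by simp [hP0 p hp], ?_⟩
      rw [← mul_zero k, ← hPL]
      simp only [ibpPairing, ContinuousMap.smul_apply, smul_eq_mul, mul_sub, ← integral_const_mul]
      congr 1 <;> refine integral_congr_ae (ae_of_all _ fun q => ?_) <;> simp only <;> ring
  -- the segments from the points of `K` to the hyperplane `ℓ = -R`
  set K' : Set (TimeSpace n) :=
    (fun x : TimeSpace n × ℝ => x.1 + ((x.2 - 1) * (ℓ x.1 + R)) • e) '' (K ×ˢ Icc 0 1) with hK'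
  have hK'c : IsCompact K' := (hK.prod isCompact_Icc).image (by fun_prop)
  obtain ⟨D, hD⟩ := hK.exists_bound_of_continuousOn (f := fun p => ℓ p + R) (by fun_prop)
  set D' := max D 0
  set A' := max A 0
  have key : ∀ ε > 0, |ibpPairing μ ν a b c (fun p => fderiv ℝ ψ p e) ψ| ≤
      ε * ((A' + D' * A') * μ.real univ + D' * A' * ν.real univ) := by
    intro ε hε
    obtain ⟨F, hF, hFK⟩ := exists_mem_span_productFunctions_near ⟨_, hψ'⟩ (hK'c.union hK) hε
    simp only [ContinuousMap.coe_mk] at hFK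
    obtain ⟨P, hP, hPd, hP0, hPL⟩ := hspan F hF
    have hclose : ∀ p ∈ K, |ψ p - P p| ≤ ε * D' := by
      intro p hp
      have hd : ∀ s ∈ Icc (0 : ℝ) 1, HasDerivWithinAt
          (fun s : ℝ => ψ (p + ((s - 1) * (ℓ p + R)) • e) - P (p + ((s - 1) * (ℓ p + R)) • e))
          ((fderiv ℝ ψ (p + ((s - 1) * (ℓ p + R)) • e) e - F (p + ((s - 1) * (ℓ p + R)) • e))
            * (ℓ p + R)) (Icc 0 1) s := by
        intro s _
        set q := p + ((s - 1) * (ℓ p + R)) • e with hq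
        have h1 : HasDerivAt (fun s : ℝ => ψ (q + s • e)) (fderiv ℝ ψ q e) 0 := by
          have h2 : HasDerivAt (fun s : ℝ => q + s • e) e 0 := by
            simpa using ((hasDerivAt_id (0 : ℝ)).smul_const e).const_add q
          have h3 := (hψd (q + (0 : ℝ) • e)).hasFDerivAt.comp_hasDerivAt 0 h2
          rw [zero_smul, add_zero] at h3
          exact h3
        have h4 := h1.sub (hPd q)
        have h5 : HasDerivAt (fun u : ℝ => (u - s) * (ℓ p + R)) (ℓ p + R) s := by
          simpa using ((hasDerivAt_id s).sub_const s).mul_const (ℓ p + R)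
        have h6 : HasDerivAt (fun s : ℝ => ψ (q + s • e) - P (q + s • e))
          (fderiv ℝ ψ q e - F q) ((s - s) * (ℓ p + R)) := by
          rw [sub_self, zero_mul]; exact h4
        have h7 := h6.comp s h5
        refine HasDerivAt.hasDerivWithinAt ?_
        convert! h7 using 1
        funext u
        have : p + ((u - 1) * (ℓ p + R)) • e = q + ((u - s) * (ℓ p + R)) • e := by
          rw [hq, add_assoc, ← add_smul]; congr 2; ring
        simp only [Function.comp, this]
      have hb' : ∀ s ∈ Ico (0 : ℝ) 1,
          ‖(fderiv ℝ ψ (p + ((s - 1) * (ℓ p + R)) • e) e - F (p + ((s - 1) * (ℓ p + R)) • e))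
            * (ℓ p + R)‖ ≤ ε * D' := by
        intro s hs
        rw [norm_mul]
        refine mul_le_mul ?_ ((hD p hp).trans (le_max_left _ _)) (norm_nonneg _) hε.le
        rw [norm_sub_rev]
        exact (hFK _ (Or.inl ⟨(p, s), ⟨hp, hs.1, hs.2.le⟩, rfl⟩)).le
      have := norm_image_sub_le_of_norm_deriv_le_segment' hd hb' 1 (by simp)
      have hface : ℓ (p + ((0 - 1) * (ℓ p + R)) • e) = -R := by
        simp [hℓ]
      simp only [hP0 _ hface, hR _ hface] at this
      simpa using this
    have i1 := (integrable_mul_of_bounded hK hμK ha hA F.continuous).add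
      (integrable_mul_of_bounded hK hμK hb hB hP)
    have i2 := (integrable_mul_of_bounded hK hμK ha hA hψ').add
      (integrable_mul_of_bounded hK hμK hb hB hψ.continuous)
    have i3 := integrable_mul_of_bounded hK hνK hc hC hP
    have i4 := integrable_mul_of_bounded hK hνK hc hC hψ.continuous
    have e1 := integral_sub i2 i1
    have e2 := integral_sub i4 i3
    have b1 := norm_integral_le_of_norm_le_const (μ := μ) (C := ε * (A' + D' * A'))
      (f := fun q => fderiv ℝ ψ q.1 e * a q + ψ q.1 * b q - (F q.1 * a q + P q.1 * b q)) (by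
        filter_upwards [hμK, hA, hB] with q hq h1 h2
        have e3 : fderiv ℝ ψ q.1 e * a q + ψ q.1 * b q - (F q.1 * a q + P q.1 * b q)
          = (fderiv ℝ ψ q.1 e - F q.1) * a q + (ψ q.1 - P q.1) * b q := by ring
        rw [e3]
        refine (norm_add_le _ _).trans ?_
        rw [norm_mul, norm_mul, mul_add, ← mul_assoc]
        refine add_le_add (mul_le_mul ?_ (h1.trans (le_max_left _ _)) (norm_nonneg _) hε.le)
          (mul_le_mul (hclose _ hq) (h2.trans (le_max_left _ _)) (norm_nonneg _)
            (by positivity))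
        rw [norm_sub_rev]
        exact (hFK _ (Or.inr hq)).le)
    have b2 := norm_integral_le_of_norm_le_const (μ := ν) (C := ε * (D' * A'))
      (f := fun q => ψ q.1 * c q - P q.1 * c q) (by
        filter_upwards [hνK, hC] with q hq h1
        rw [← sub_mul, norm_mul, ← mul_assoc]
        exact mul_le_mul (hclose _ hq) (h1.trans (le_max_left _ _)) (norm_nonneg _)
            (by positivity))
    simp only [ibpPairing, Pi.add_apply] at hPL e1 e2 ⊢
    rw [e1] at b1
    rw [e2] at b2
    rw [Real.norm_eq_abs] at b1 b2
    have b3 := abs_le.1 b1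
    have b4 := abs_le.1 b2
    rw [abs_le]
    constructor <;> nlinarith
  by_contra hne
  have hpos : 0 < |ibpPairing μ ν a b c (fun p => fderiv ℝ ψ p e) ψ| := abs_pos.2 hne
  set X := |ibpPairing μ ν a b c (fun p => fderiv ℝ ψ p e) ψ|
  set W := (A' + D' * A') * μ.real univ + D' * A' * ν.real univ
  have hW : 0 ≤ W := by positivity
  have := key (X / (2 * (W + 1))) (by positivity)
  rw [div_mul_eq_mul_div, le_div_iff₀ (by positivity)] at this
  nlinarith

end Density

/-! ### Smooth functions and functions in `W₀^{1,2}` as elements of `H¹` with trace -/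

section SmoothFunctions

variable {n : ℕ} {Ω : Set (Space n)}

lemma inner_gradient (v : Space n → ℝ) (x h : Space n) :
    inner ℝ (gradient v x) h = fderiv ℝ v x h := by
  rw [gradient, InnerProductSpace.toDual_symm_apply]

lemma gradient_apply (v : Space n → ℝ) (x : Space n) (j : Fin n) :
    gradient v x j = fderiv ℝ v x (EuclideanSpace.single j 1) := by
  rw [← inner_gradient, EuclideanSpace.inner_single_right]; simp

lemma continuous_gradient {v : Space n → ℝ} (hv : ContDiff ℝ ∞ v) : Continuous (gradient v) :=
  (LinearIsometryEquiv.continuous _).comp (hv.continuous_fderiv (by simp))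

lemma memLp_of_continuous_of_isBounded {F : Type*} [NormedAddCommGroup F]
    [SecondCountableTopology F] [MeasurableSpace F] [BorelSpace F]
    (hΩb : Bornology.IsBounded Ω) (hΩm : MeasurableSet Ω) {v : Space n → F}
    (hv : Continuous v) (p : ℝ≥0∞) : MemLp v p (volume.restrict Ω) := by
  obtain ⟨B, hB⟩ := hΩb.isCompact_closure.exists_bound_of_continuousOn hv.continuousOn
  have : IsFiniteMeasure (volume.restrict Ω) := ⟨by simpa using hΩb.measure_lt_top⟩
  refine MemLp.of_bound hv.aestronglyMeasurable B ?_
  filter_upwards [ae_restrict_mem hΩm] with x hx using hB x (subset_closure hx)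

/-- Smooth functions are in `H¹` and their trace is their restriction. -/
lemma memH1WithTrace_of_contDiff (hΩo : IsOpen Ω) (hΩb : Bornology.IsBounded Ω)
    {v : Space n → ℝ} (hv : ContDiff ℝ ∞ v) : MemH1WithTrace Ω v (gradient v) := by
  refine ⟨⟨memLp_of_continuous_of_isBounded hΩb hΩo.measurableSet hv.continuous 2,
    memLp_of_continuous_of_isBounded hΩb hΩo.measurableSet (continuous_gradient hv) 2, ?_⟩,
    hv.continuous.aestronglyMeasurable, fun _ => v, fun _ => hv, by simp, by simp, by simp⟩
  rintro ψ ⟨hψ, hψc, hψΩ⟩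
  have h0 : ∀ x ∉ Ω, ψ x = 0 := fun x hx => image_eq_zero_of_notMem_tsupport fun h => hx (hψΩ h)
  have h1 : ∀ x ∉ Ω, gradient ψ x = 0 := fun x hx => by
    have : fderiv ℝ ψ x = 0 :=
      image_eq_zero_of_notMem_tsupport fun h => hx (hψΩ (tsupport_fderiv_subset ℝ h))
    rw [gradient, this, map_zero]
  rw [setIntegral_eq_integral_of_forall_compl_eq_zero (fun x hx => by rw [h1 x hx, smul_zero]),
    setIntegral_eq_integral_of_forall_compl_eq_zero (fun x hx => by rw [h0 x hx, zero_smul])]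
  have hψ'c : HasCompactSupport (gradient ψ) := by
    refine (hψc.fderiv ℝ).mono fun x hx => ?_
    rw [Function.mem_support] at hx ⊢
    contrapose! hx
    rw [gradient, hx, map_zero]
  have i1 : Integrable (fun x => v x • gradient ψ x) :=
    (hv.continuous.smul (continuous_gradient hψ)).integrable_of_hasCompactSupport hψ'c.smul_left
  have i2 : Integrable (fun x => ψ x • gradient v x) :=
    (hψ.continuous.smul (continuous_gradient hv)).integrable_of_hasCompactSupport hψc.smul_right
  refine ext_inner_left ℝ fun h => ?_
  rw [inner_neg_right, ← integral_inner i1, ← integral_inner i2]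
  have j1 := i1.inner_const (𝕜 := ℝ) h
  have j2 := i2.inner_const (𝕜 := ℝ) h
  simp only [real_inner_smul_left, inner_gradient] at j1 j2
  simp only [real_inner_comm _ h, real_inner_smul_left, inner_gradient]
  rw [integral_mul_fderiv_eq_neg_fderiv_mul_of_integrable
    (by simpa only [mul_comm] using j2) j1
    ((hv.continuous.mul hψ.continuous).integrable_of_hasCompactSupport hψc.mul_left)
    (fun x _ => hv.differentiable (by simp) x) (fun x _ => hψ.differentiable (by simp) x)]
  simp only [mul_comm]

/-- The extension by zero of an element of `W₀^{1,2}(Ω)` has zero trace. -/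
lemma MemW10.memH1WithTrace_indicator (hΩo : IsOpen Ω) {v : Space n → ℝ} {g : Space n → Space n}
    (h : MemW10 Ω 2 v g) : MemH1WithTrace Ω (Ω.indicator v) g := by
  obtain ⟨⟨hv, hg, hvg⟩, ψ, hψ, hψv, hψg⟩ := h
  have hae : Ω.indicator v =ᵐ[volume.restrict Ω] v := indicator_ae_eq_restrict hΩo.measurableSet
  have hfr : ∀ x ∈ frontier Ω, x ∉ Ω := fun x hx => by
    rw [hΩo.frontier_eq] at hx; exact hx.2
  have hfm : ∀ᵐ x ∂surfaceMeasure Ω, x ∈ frontier Ω :=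
    ae_restrict_mem isClosed_frontier.measurableSet
  refine ⟨⟨(memLp_congr_ae hae).2 hv, hg, fun χ hχ => ?_⟩, ?_, ψ, fun k => (hψ k).1, ?_, hψg, ?_⟩
  · rw [← hvg χ hχ]
    exact integral_congr_ae (by filter_upwards [hae] with x hx; rw [hx])
  · refine (aestronglyMeasurable_const (b := (0 : ℝ))).congr ?_
    filter_upwards [hfm] with x hx
    rw [indicator_of_notMem (hfr x hx)]
  · refine hψv.congr fun k => eLpNorm_congr_ae ?_
    filter_upwards [hae] with x hx
    rw [hx]
  · refine tendsto_const_nhds.congr fun k => ?_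
    rw [eq_comm]
    refine (eLpNorm_congr_ae (g := fun _ => (0 : ℝ)) ?_).trans (eLpNorm_zero')
    filter_upwards [hfm] with x hx
    rw [indicator_of_notMem (hfr x hx), sub_zero]
    exact image_eq_zero_of_notMem_tsupport fun h => hfr x hx ((hψ k).2.2 h)

end SmoothFunctions

/-! ### Antiderivatives of products -/

section Antiderivatives

variable {n : ℕ}

/-- A smooth function of one variable has a smooth antiderivative that vanishes at a given point. -/
lemma exists_smooth_antiderivative {w : ℝ → ℝ} (hw : ContDiff ℝ ∞ w) (a : ℝ) :
    ∃ W : ℝ → ℝ, ContDiff ℝ ∞ W ∧ W a = 0 ∧ ∀ s, HasDerivAt W (w s) s := by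
  have hd : ∀ s, HasDerivAt (fun s => ∫ u in a..s, w u) (w s) s := fun s =>
    intervalIntegral.integral_hasDerivAt_right (hw.continuous.intervalIntegrable _ _)
      (hw.continuous.stronglyMeasurableAtFilter _ _) hw.continuous.continuousAt
  refine ⟨_, ?_, intervalIntegral.integral_same, hd⟩
  rw [contDiff_infty_iff_deriv]
  refine ⟨fun s => (hd s).differentiableAt, ?_⟩
  rwa [show deriv (fun s => ∫ u in a..s, w u) = w from funext fun s => (hd s).deriv]

lemma contDiff_prod_coord {w : Fin n → ℝ → ℝ} (hw : ∀ l, ContDiff ℝ ∞ (w l)) :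
    ContDiff ℝ ∞ fun x : Space n => ∏ l, w l (x l) :=
  contDiff_prod fun l _ => (hw l).comp (contDiff_euclidean.1 contDiff_id l)

lemma prod_update_eq {w : Fin n → ℝ → ℝ} (j : Fin n) (W : ℝ → ℝ) (x : Space n) :
    ∏ l, Function.update w j W l (x l) = W (x j) * ∏ l ∈ Finset.univ.erase j, w l (x l) := by
  rw [← Finset.mul_prod_erase _ _ (Finset.mem_univ j), Function.update_self]
  congr 1
  refine Finset.prod_congr rfl fun l hl => ?_
  rw [Function.update_of_ne (Finset.ne_of_mem_erase hl)]

lemma hasDerivAt_prod_update {w : Fin n → ℝ → ℝ} {j : Fin n} {W : ℝ → ℝ}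
    (hW : ∀ s, HasDerivAt W (w j s) s) (x : Space n) :
    HasDerivAt (fun s : ℝ => ∏ l, Function.update w j W l
        ((x + s • EuclideanSpace.single j (1 : ℝ) : Space n) l))
      (∏ l, w l (x l)) 0 := by
  have h1 : ∀ s : ℝ, ∏ l, Function.update w j W l
      ((x + s • EuclideanSpace.single j (1 : ℝ) : Space n) l) =
      W (x j + s) * ∏ l ∈ Finset.univ.erase j, w l (x l) := by
    intro s
    rw [prod_update_eq]
    congr 1
    · simp
    · refine Finset.prod_congr rfl fun l hl => ?_
      simp [Finset.ne_of_mem_erase hl]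
  simp only [h1]
  rw [← Finset.mul_prod_erase _ _ (Finset.mem_univ j)]
  refine HasDerivAt.mul_const ?_ _
  have h2 := hW (x j)
  have h3 := HasDerivAt.comp_const_add (x j) 0 (by simpa using h2)
  simpa using h3

lemma gradient_prod_update_apply {w : Fin n → ℝ → ℝ} (hw : ∀ l, ContDiff ℝ ∞ (w l)) {j : Fin n}
    {W : ℝ → ℝ} (hWs : ContDiff ℝ ∞ W) (hW : ∀ s, HasDerivAt W (w j s) s) (x : Space n) :
    gradient (fun x : Space n => ∏ l, Function.update w j W l (x l)) x j = ∏ l, w l (x l) := by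
  have hu : ∀ l, ContDiff ℝ ∞ (Function.update w j W l) := by
    intro l
    by_cases hl : l = j
    · subst hl; simpa using hWs
    · simpa [hl] using hw l
  have hd : Differentiable ℝ (fun x : Space n => ∏ l, Function.update w j W l (x l)) :=
    (contDiff_prod_coord hu).differentiable (by simp)
  rw [gradient_apply, ← (hd x).lineDeriv_eq_fderiv]
  exact (hasDerivAt_prod_update hW x).deriv

end Antiderivatives

/-! ### Measurability of the outward normal -/

section Normal

variable {n : ℕ} {Ω : Set (Space n)}

/-- There is at most one outward unit normal: for two different ones `ν`, `ν'`, the points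
`x + t (ν - ν')` would be on both sides of the boundary. -/
lemma IsOutwardNormal.unique {x ν ν' : Space n} (h : IsOutwardNormal Ω x ν)
    (h' : IsOutwardNormal Ω x ν') : ν = ν' := by
  by_contra hne
  set d := ν - ν' with hd
  have hd0 : 0 < ‖d‖ := norm_pos_iff.2 (sub_ne_zero.2 hne)
  have hsq : ‖d‖ ^ 2 = 2 - 2 * inner ℝ ν ν' := by
    rw [hd, norm_sub_sq_real, h.1, h'.1]; ring
  have e1 : inner ℝ ν d = ‖d‖ ^ 2 / 2 := by
    rw [hsq, hd, inner_sub_right, real_inner_self_eq_norm_sq, h.1]; ring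
  have e2 : inner ℝ ν' d = -(‖d‖ ^ 2 / 2) := by
    rw [hsq, hd, inner_sub_right, real_inner_self_eq_norm_sq, h'.1, real_inner_comm]; ring
  obtain ⟨δ, hδ, H⟩ := h.2 (‖d‖ / 4) (by positivity)
  obtain ⟨δ', hδ', H'⟩ := h'.2 (‖d‖ / 4) (by positivity)
  set t := min δ δ' / (2 * ‖d‖) with ht
  have hm : 0 < min δ δ' := lt_min hδ hδ'
  have htpos : 0 < t := by positivity
  have hn : ‖x + t • d - x‖ = t * ‖d‖ := by
    rw [add_sub_cancel_left, norm_smul, Real.norm_of_nonneg htpos.le]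
  have hlt : t * ‖d‖ < min δ δ' := by
    rw [ht, div_mul_eq_mul_div, div_lt_iff₀ (by positivity)]; nlinarith
  have A := (H (x + t • d) (by rw [hn]; exact hlt.trans_le (min_le_left _ _))).2
  have B := (H' (x + t • d) (by rw [hn]; exact hlt.trans_le (min_le_right _ _))).1
  rw [hn, add_sub_cancel_left, inner_smul_right] at A B
  rw [e1] at A
  rw [e2] at B
  have hp : 0 < t * ‖d‖ ^ 2 := by positivity
  exact A (by nlinarith) (subset_closure (B (by nlinarith)))

lemma outwardNormal_eq {x ν : Space n} (h : IsOutwardNormal Ω x ν) : outwardNormal Ω x = ν := by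
  have hex : ∃ ν, IsOutwardNormal Ω x ν := ⟨ν, h⟩
  rw [outwardNormal, dif_pos hex]
  exact hex.choose_spec.unique h

lemma norm_outwardNormal_le (x : Space n) : ‖outwardNormal Ω x‖ ≤ 1 := by
  by_cases h : ∃ ν, IsOutwardNormal Ω x ν
  · obtain ⟨ν, hν⟩ := h
    rw [outwardNormal_eq hν, hν.1]
  · rw [outwardNormal, dif_neg h]; simp

/-- The graph of the normal field is a Borel set: it suffices to take `ε` and `δ` of the form
`1 / (k + 1)`, and for fixed `ε` and `δ` the condition is closed. -/
lemma measurableSet_isOutwardNormal :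
    MeasurableSet {q : Space n × Space n | IsOutwardNormal Ω q.1 q.2} := by
  let S : ℝ → ℝ → Set (Space n × Space n) := fun ε δ => {q | ∀ y : Space n, ‖y - q.1‖ < δ →
    (inner ℝ q.2 (y - q.1) < -(ε * ‖y - q.1‖) → y ∈ Ω) ∧
    (ε * ‖y - q.1‖ < inner ℝ q.2 (y - q.1) → y ∉ closure Ω)}
  have hS : ∀ ε δ, IsClosed (S ε δ) := by
    intro ε δ
    have : S ε δ = ⋂ y : Space n, ({q | ‖y - q.1‖ < δ ∧
        ((inner ℝ q.2 (y - q.1) < -(ε * ‖y - q.1‖) ∧ y ∉ Ω) ∨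
          (ε * ‖y - q.1‖ < inner ℝ q.2 (y - q.1) ∧ y ∈ closure Ω))})ᶜ := by
      ext q
      simp only [S, mem_iInter, mem_compl_iff, mem_ofPred_eq]
      refine forall_congr' fun y => ?_
      tauto
    rw [this]
    refine isClosed_iInter fun y => IsOpen.isClosed_compl ?_
    have c1 : Continuous fun q : Space n × Space n => ‖y - q.1‖ := by fun_prop
    have c2 : Continuous fun q : Space n × Space n => inner ℝ q.2 (y - q.1) := by fun_prop
    exact (isOpen_lt c1 continuous_const).inter
      (((isOpen_lt c2 (c1.const_mul ε).neg).inter isOpen_const).union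
        ((isOpen_lt (c1.const_mul ε) c2).inter isOpen_const))
  have hG : {q : Space n × Space n | IsOutwardNormal Ω q.1 q.2} =
      {q | ‖q.2‖ = 1} ∩ ⋂ k : ℕ, ⋃ m : ℕ, S (1 / ((k : ℝ) + 1)) (1 / ((m : ℝ) + 1)) := by
    ext q
    simp only [mem_inter_iff, mem_ofPred_eq, IsOutwardNormal, mem_iInter, mem_iUnion]
    refine and_congr_right fun _ => ⟨fun h k => ?_, fun h ε hε => ?_⟩
    · obtain ⟨δ, hδ, H⟩ := h (1 / ((k : ℝ) + 1)) (by positivity)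
      obtain ⟨m, hm⟩ := exists_nat_one_div_lt hδ
      exact ⟨m, fun y hy => H y (hy.trans hm)⟩
    · obtain ⟨k, hk⟩ := exists_nat_one_div_lt hε
      obtain ⟨m, hm⟩ := h k
      refine ⟨1 / ((m : ℝ) + 1), by positivity, fun y hy => ?_⟩
      have hle : 1 / ((k : ℝ) + 1) * ‖y - q.1‖ ≤ ε * ‖y - q.1‖ :=
        mul_le_mul_of_nonneg_right hk.le (norm_nonneg _)
      exact ⟨fun h' => (hm y hy).1 (by linarith), fun h' => (hm y hy).2 (by linarith)⟩
  rw [hG]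
  refine (isClosed_eq (by fun_prop) continuous_const).measurableSet.inter ?_
  exact MeasurableSet.iInter fun k => MeasurableSet.iUnion fun m => (hS _ _).measurableSet

/-- The outward normal is Borel measurable: its graph over the set where it exists is a Borel set,
and injective images of Borel sets are Borel sets. -/
lemma measurable_outwardNormal : Measurable (outwardNormal Ω) := by
  set G := {q : Space n × Space n | IsOutwardNormal Ω q.1 q.2} with hG
  have hGm : MeasurableSet G := measurableSet_isOutwardNormal
  have hinj : InjOn Prod.fst G := fun q hq q' hq' h =>
    Prod.ext h (IsOutwardNormal.unique hq (by rw [h]; exact hq'))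
  have hdom : MeasurableSet (Prod.fst '' G) := hGm.image_of_measurable_injOn measurable_fst hinj
  intro B hB
  have : outwardNormal Ω ⁻¹' B = Prod.fst '' (G ∩ Prod.snd ⁻¹' B) ∪
      ((Prod.fst '' G)ᶜ ∩ {_x | (0 : Space n) ∈ B}) := by
    ext x
    by_cases h : ∃ ν, IsOutwardNormal Ω x ν
    · obtain ⟨ν, hν⟩ := h
      have hx : x ∈ Prod.fst '' G := ⟨(x, ν), hν, rfl⟩
      rw [mem_preimage, outwardNormal_eq hν]
      constructor
      · exact fun hb => Or.inl ⟨(x, ν), ⟨hν, hb⟩, rfl⟩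
      · rintro (⟨q, ⟨hq, hqB⟩, rfl⟩ | hx')
        · rwa [hν.unique hq]
        · exact absurd hx hx'.1
    · have hx : x ∉ Prod.fst '' G := by
        rintro ⟨q, hq, rfl⟩
        exact h ⟨q.2, hq⟩
      rw [mem_preimage, outwardNormal, dif_neg h]
      constructor
      · exact fun hb => Or.inr ⟨hx, hb⟩
      · rintro (⟨q, ⟨hq, hqB⟩, rfl⟩ | hx')
        · exact absurd ⟨q, hq, rfl⟩ hx
        · exact hx'.2
  rw [this]
  refine ((hGm.inter (measurable_snd hB)).image_of_measurable_injOn measurable_fst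
    (hinj.mono inter_subset_left)).union (hdom.compl.inter (MeasurableSet.const _))

lemma measurable_normalSpace (T : ℝ) : Measurable (normalSpace T Ω) := by
  refine Measurable.ite ?_ measurable_const (measurable_outwardNormal.comp measurable_snd)
  exact (measurable_fst (measurableSet_singleton 0)).union
    (measurable_fst (measurableSet_singleton T))

lemma norm_normalSpace_le (T : ℝ) (p : TimeSpace n) : ‖normalSpace T Ω p‖ ≤ 1 := by
  rw [normalSpace]
  split_ifs
  · simp
  · exact norm_outwardNormal_le _

lemma measurable_normalTime (T : ℝ) : Measurable (normalTime (n := n) T) :=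
  Measurable.ite (measurable_fst (measurableSet_singleton 0)) measurable_const
    (Measurable.ite (measurable_fst (measurableSet_singleton T)) measurable_const measurable_const)

lemma abs_normalTime_le (T : ℝ) (p : TimeSpace n) : |normalTime T p| ≤ 1 := by
  rw [normalTime]
  split_ifs <;> simp

end Normal

/-! ### Occupation measures: marginal and integration by parts -/

/-- Finite measures on `(t, x)`-space that are carried by a compact set are determined by the
integrals of products of smooth functions of one variable. -/
lemma measure_ext_of_productFunctions {n : ℕ} {μ ν : Measure (TimeSpace n)} [IsFiniteMeasure μ]
    [IsFiniteMeasure ν] {K : Set (TimeSpace n)} (hK : IsCompact K) (hμ : ∀ᵐ p ∂μ, p ∈ K)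
    (hν : ∀ᵐ p ∂ν, p ∈ K) (h : ∀ F ∈ productFunctions n, ∫ p, F p ∂μ = ∫ p, F p ∂ν) : μ = ν := by
  have hint : ∀ (ρ : Measure (TimeSpace n)) [IsFiniteMeasure ρ], (∀ᵐ p ∂ρ, p ∈ K) →
      ∀ F : C(TimeSpace n, ℝ), Integrable F ρ := by
    intro ρ _ hρ F
    obtain ⟨B, hB⟩ := hK.exists_bound_of_continuousOn F.continuous.continuousOn
    exact Integrable.of_bound F.continuous.aestronglyMeasurable B (hρ.mono hB)
  have hspan : ∀ F ∈ Submodule.span ℝ (productFunctions n), ∫ p, F p ∂μ = ∫ p, F p ∂ν := by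
    intro F hF
    induction hF using Submodule.span_induction with
    | mem F hF => exact h F hF
    | zero => simp
    | add F G _ _ hF hG =>
      simp only [ContinuousMap.add_apply]
      rw [integral_add (hint μ hμ F) (hint μ hμ G), integral_add (hint ν hν F) (hint ν hν G),
        hF, hG]
    | smul k F _ hF =>
      simp only [ContinuousMap.smul_apply, integral_smul]
      rw [hF]
  refine ext_of_forall_integral_eq_of_IsFiniteMeasure fun f => ?_
  have key : ∀ ε > 0, |∫ p, f p ∂μ - ∫ p, f p ∂ν| ≤ ε * (μ.real univ + ν.real univ) := by
    intro ε hε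
    obtain ⟨P, hP, hPK⟩ := exists_mem_span_productFunctions_near f.toContinuousMap hK hε
    have hb : ∀ (ρ : Measure (TimeSpace n)) [IsFiniteMeasure ρ], (∀ᵐ p ∂ρ, p ∈ K) →
        |∫ p, P p ∂ρ - ∫ p, f p ∂ρ| ≤ ε * ρ.real univ := by
      intro ρ _ hρ
      have hf : Integrable (fun p => f p) ρ := hint ρ hρ f.toContinuousMap
      rw [← integral_sub (hint ρ hρ P) hf]
      exact norm_integral_le_of_norm_le_const (f := fun p => P p - f p)
        (hρ.mono fun p hp => (hPK p hp).le)
    have h1 := abs_le.1 (hb μ hμ)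
    have h2 := abs_le.1 (hb ν hν)
    have h3 := hspan P hP
    rw [abs_le]
    constructor <;> nlinarith
  by_contra hne
  have hpos : 0 < |∫ p, f p ∂μ - ∫ p, f p ∂ν| := abs_pos.2 (sub_ne_zero.2 hne)
  set X := |∫ p, f p ∂μ - ∫ p, f p ∂ν|
  set W := μ.real univ + ν.real univ
  have hW : 0 ≤ W := by positivity
  have := key (X / (2 * (W + 1))) (by positivity)
  rw [div_mul_eq_mul_div, le_div_iff₀ (by positivity)] at this
  nlinarith

/-- The standing assumptions: a bounded Lipschitz domain, a reaction term, compact sets of values,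
and a pair of measures on `Q_T × Y × Z` and `∂Q_T × Y × Z` with the occupation-measure identities. -/
structure IsOccupationPair {n : ℕ} (T : ℝ) (Ω : Set (Space n)) (f : ℝ → Space n → ℝ → ℝ)
    (y₀ : Space n → ℝ) (Y : Set ℝ) (Z : Set (ℝ × Space n)) (μ μb : Measure (TimeSpace n × Val n)) :
    Prop where
  pos : 0 < T
  isOpen : IsOpen Ω
  isBounded : Bornology.IsBounded Ω
  lipschitz : HasLipschitzBoundary Ω
  reaction : IsReactionTerm T Ω f
  compact_Y : IsCompact Y
  compact_Z : IsCompact Z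
  supp : μ (closedCylinder T Ω ×ˢ (Y ×ˢ Z))ᶜ = 0
  supp_boundary : μb (cylinderBoundary T Ω ×ˢ (Y ×ˢ Z))ᶜ = 0
  identities : OccupationIdentities T Ω f y₀ μ μb

section Cylinder

variable {n : ℕ} {T : ℝ} {Ω : Set (Space n)}

lemma isCompact_closedCylinder (hΩ : Bornology.IsBounded Ω) : IsCompact (closedCylinder T Ω) :=
  isCompact_Icc.prod hΩ.isCompact_closure

lemma cylinderBoundary_subset (hT : 0 ≤ T) : cylinderBoundary T Ω ⊆ closedCylinder T Ω := by
  refine iUnion_subset fun i => ?_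
  fin_cases i
  · exact prod_mono (by simpa using hT) subset_rfl
  · exact prod_mono (by simpa using hT) subset_rfl
  · exact prod_mono subset_rfl frontier_subset_closure

lemma measurableSet_boundaryPiece (i : Fin 3) : MeasurableSet (boundaryPiece T Ω i) := by
  fin_cases i
  · exact (measurableSet_singleton 0).prod isClosed_closure.measurableSet
  · exact (measurableSet_singleton T).prod isClosed_closure.measurableSet
  · exact measurableSet_Icc.prod isClosed_frontier.measurableSet

lemma HasLipschitzBoundary.Icc_prod_closure_ae_eq (hΩ : HasLipschitzBoundary Ω)
    (hΩo : IsOpen Ω) : closedCylinder T Ω =ᵐ[volume] (Icc 0 T ×ˢ Ω : Set (TimeSpace n)) := by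
  rw [Measure.volume_eq_prod]
  exact Measure.set_prod_ae_eq (ae_eq_refl _)
    (closure_ae_eq_of_null_frontier (hΩ.volume_frontier hΩo))

lemma Ioo_prod_ae_eq_Icc_prod :
    (Ioo 0 T ×ˢ Ω : Set (TimeSpace n)) =ᵐ[volume] (Icc 0 T ×ˢ Ω : Set (TimeSpace n)) := by
  rw [Measure.volume_eq_prod]
  exact Measure.set_prod_ae_eq Ioo_ae_eq_Icc (ae_eq_refl _)

lemma isFiniteMeasure_restrict_prod (hΩ : Bornology.IsBounded Ω) :
    IsFiniteMeasure (volume.restrict (Icc 0 T ×ˢ Ω : Set (TimeSpace n))) :=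
  ⟨by
    rw [Measure.restrict_apply_univ]
    exact ((Metric.isBounded_Icc 0 T).prod hΩ).measure_lt_top⟩

/-- On the boundary of the cylinder, integration against the time component of the normal is the
difference of the integrals over top and bottom. -/
lemma integral_mul_normalTime {V : Type*} [MeasurableSpace V] (hT : 0 < T)
    {ν : Measure (TimeSpace n × V)} (hν : ∀ᵐ q ∂ν, q.1 ∈ cylinderBoundary T Ω)
    {G : TimeSpace n × V → ℝ} (hG : Integrable G ν) :
    ∫ q, G q * normalTime T q.1 ∂ν = (∫ q in boundaryPiece T Ω 1 ×ˢ univ, G q ∂ν) -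
      ∫ q in boundaryPiece T Ω 0 ×ˢ univ, G q ∂ν := by
  have m0 : MeasurableSet (boundaryPiece T Ω 0 ×ˢ (univ : Set V)) :=
    (measurableSet_boundaryPiece 0).prod .univ
  have m1 : MeasurableSet (boundaryPiece T Ω 1 ×ˢ (univ : Set V)) :=
    (measurableSet_boundaryPiece 1).prod .univ
  rw [← integral_indicator m0, ← integral_indicator m1,
    ← integral_sub (hG.indicator m1) (hG.indicator m0)]
  refine integral_congr_ae ?_
  filter_upwards [hν] with q hq
  have hcl : q.1.2 ∈ closure Ω := (cylinderBoundary_subset hT.le hq).2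
  have e0 : q ∈ boundaryPiece T Ω 0 ×ˢ (univ : Set V) ↔ q.1.1 = 0 := by
    simp [boundaryPiece, mem_prod, hcl]
  have e1 : q ∈ boundaryPiece T Ω 1 ×ˢ (univ : Set V) ↔ q.1.1 = T := by
    simp [boundaryPiece, mem_prod, hcl]
  by_cases h0 : q.1.1 = 0
  · rw [indicator_of_mem (e0.2 h0), indicator_of_notMem (by rw [e1, h0]; exact hT.ne)]
    simp [normalTime, h0]
  · by_cases h1 : q.1.1 = T
    · rw [indicator_of_notMem (mt e0.1 h0), indicator_of_mem (e1.2 h1)]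
      simp [normalTime, h1, hT.ne']
    · rw [indicator_of_notMem (mt e0.1 h0), indicator_of_notMem (mt e1.1 h1)]
      simp [normalTime, h0, h1]

end Cylinder

namespace IsOccupationPair

variable {n : ℕ} {T : ℝ} {Ω : Set (Space n)} {f : ℝ → Space n → ℝ → ℝ} {y₀ : Space n → ℝ}
  {Y : Set ℝ} {Z : Set (ℝ × Space n)} {μ μb : Measure (TimeSpace n × Val n)}

lemma isCompact_values (h : IsOccupationPair T Ω f y₀ Y Z μ μb) : IsCompact (Y ×ˢ Z) :=
  h.compact_Y.prod h.compact_Z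

lemma ae_mem (h : IsOccupationPair T Ω f y₀ Y Z μ μb) :
    ∀ᵐ q ∂μ, q.1 ∈ closedCylinder T Ω ∧ q.2 ∈ Y ×ˢ Z :=
  measure_mono_null (fun _ hq hq' => hq hq') h.supp

lemma ae_mem_boundary (h : IsOccupationPair T Ω f y₀ Y Z μ μb) :
    ∀ᵐ q ∂μb, q.1 ∈ cylinderBoundary T Ω ∧ q.2 ∈ Y ×ˢ Z :=
  measure_mono_null (fun _ hq hq' => hq hq') h.supp_boundary

/-- Continuous functions of the values are bounded on `Y × Z`, hence almost everywhere for both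
measures. -/
lemma exists_bound (h : IsOccupationPair T Ω f y₀ Y Z μ μb) {g : Val n → ℝ} (hg : Continuous g) :
    ∃ A, 0 ≤ A ∧ (∀ ξ ∈ Y ×ˢ Z, |g ξ| ≤ A) ∧ (∀ᵐ q ∂μ, |g q.2| ≤ A) ∧ ∀ᵐ q ∂μb, |g q.2| ≤ A := by
  obtain ⟨A, hA⟩ := h.isCompact_values.exists_bound_of_continuousOn hg.continuousOn
  have hA' : ∀ ξ ∈ Y ×ˢ Z, |g ξ| ≤ max A 0 := fun ξ hξ => (hA ξ hξ).trans (le_max_left _ _)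
  exact ⟨max A 0, le_max_right _ _, hA', h.ae_mem.mono fun q hq => hA' _ hq.2,
    h.ae_mem_boundary.mono fun q hq => hA' _ hq.2⟩

lemma aestronglyMeasurable_val {ν : Measure (TimeSpace n × Val n)} {g : Val n → ℝ}
    (hg : Continuous g) : AEStronglyMeasurable (fun q => g q.2) ν :=
  (hg.measurable.comp measurable_snd).aestronglyMeasurable

lemma integrable_boundary [IsFiniteMeasure μb] (h : IsOccupationPair T Ω f y₀ Y Z μ μb)
    {F : TimeSpace n → ℝ} (hF : Continuous F) {g : Val n → ℝ} (hg : Continuous g) :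
    Integrable (fun q => F q.1 * g q.2) μb := by
  obtain ⟨A, -, -, -, hA⟩ := h.exists_bound hg
  exact integrable_mul_of_bounded (isCompact_closedCylinder h.isBounded)
    (h.ae_mem_boundary.mono fun q hq => cylinderBoundary_subset h.pos.le hq.1)
    (aestronglyMeasurable_val hg) hA hF

/-- The `(t, x)`-marginal of the occupation measure is the Lebesgue measure on the cylinder: apply
the time identity with `β = 1` to the time antiderivative of a product and use the
normalization of the boundary measure on top and bottom. -/
lemma map_fst [IsFiniteMeasure μ] [IsFiniteMeasure μb]
    (h : IsOccupationPair T Ω f y₀ Y Z μ μb) :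
    μ.map Prod.fst = volume.restrict (closedCylinder T Ω) := by
  have hQ : IsCompact (closedCylinder T Ω) := isCompact_closedCylinder h.isBounded
  have : IsFiniteMeasure (volume.restrict (closedCylinder T Ω)) :=
    ⟨by rw [Measure.restrict_apply_univ]; exact hQ.measure_lt_top⟩
  refine measure_ext_of_productFunctions hQ ?_ (ae_restrict_mem hQ.measurableSet) ?_
  · exact (ae_map_iff measurable_fst.aemeasurable hQ.measurableSet).2 (h.ae_mem.mono fun q hq => hq.1)
  rintro F ⟨φ, w, hφ, hw, hF⟩
  obtain ⟨Φ, hΦ, hΦ0, hΦd⟩ := exists_smooth_antiderivative hφ 0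
  set v : Space n → ℝ := fun x => ∏ l, w l (x l) with hv
  have hvs : ContDiff ℝ ∞ v := contDiff_prod_coord hw
  have hΦv : ContDiff ℝ ∞ fun p : TimeSpace n => Φ p.1 * v p.2 :=
    (hΦ.comp contDiff_fst).mul (hvs.comp contDiff_snd)
  have key := h.identities.ibp_time Φ v _ (fun _ => 1) hΦ
    (memH1WithTrace_of_contDiff h.isOpen h.isBounded hvs) contDiff_const
  have hd : deriv Φ = φ := funext fun t => (hΦd t).deriv
  simp only [mul_one, deriv_const, mul_zero, add_zero, hd] at key
  have hint : Integrable (fun q : TimeSpace n × Val n => Φ q.1.1 * v q.1.2) μb := by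
    simpa using h.integrable_boundary hΦv.continuous (g := fun _ => 1) continuous_const
  rw [integral_mul_normalTime h.pos (h.ae_mem_boundary.mono fun q hq => hq.1) hint,
    h.identities.normalization _ hΦv 1, h.identities.normalization _ hΦv 0] at key
  simp only [boundarySurface, Matrix.cons_val_one, Matrix.cons_val_zero] at key
  rw [integral_prod_mul, integral_prod_mul, integral_dirac, integral_dirac, hΦ0, zero_mul,
    sub_zero, sub_eq_zero] at key
  rw [integral_map measurable_fst.aemeasurable F.continuous.aestronglyMeasurable]
  simp only [hF]
  rw [key, closedCylinder, Measure.volume_eq_prod, setIntegral_prod_mul φ v,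
    integral_Icc_eq_integral_Ioc, ← intervalIntegral.integral_of_le h.pos.le,
    intervalIntegral.integral_eq_sub_of_hasDerivAt (fun t _ => hΦd t)
      (hφ.continuous.intervalIntegrable _ _), hΦ0, sub_zero]

/-- The solution vanishes on the lateral boundary: use `β(y) = y²` in the boundary identity. -/
lemma ae_lateral_eq_zero [IsFiniteMeasure μb] (h : IsOccupationPair T Ω f y₀ Y Z μ μb) :
    ∀ᵐ q ∂μb, q.1 ∈ boundaryPiece T Ω 2 → q.2.1 = 0 := by
  have key := h.identities.boundary (fun _ => 1) (fun _ => 1) _ (fun y => y ^ 2) contDiff_const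
    (memH1WithTrace_of_contDiff h.isOpen h.isBounded contDiff_const) (contDiff_id.pow 2)
  simp only [one_mul, ne_eq, OfNat.ofNat_ne_zero, not_false_eq_true, zero_pow, integral_zero] at key
  have hint : Integrable (fun q : TimeSpace n × Val n => q.2.1 ^ 2) μb := by
    simpa using h.integrable_boundary (F := fun _ => 1) continuous_const
      (g := fun ξ => ξ.1 ^ 2) (by fun_prop)
  rw [integral_eq_zero_iff_of_nonneg (fun q => sq_nonneg _) hint.integrableOn] at key
  have := (ae_restrict_iff' ((measurableSet_boundaryPiece (T := T) (Ω := Ω) 2).prod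
    (MeasurableSet.univ : MeasurableSet (univ : Set (Val n))))).1 key
  filter_upwards [this] with q hq hq'
  exact pow_eq_zero_iff (two_ne_zero) |>.1 (hq ⟨hq', mem_univ _⟩)

lemma normalSpace_mul_eq_zero [IsFiniteMeasure μb] (h : IsOccupationPair T Ω f y₀ Y Z μ μb)
    {β : ℝ → ℝ} (hβ : β 0 = 0) (j : Fin n) :
    ∀ᵐ q ∂μb, β q.2.1 * normalSpace T Ω q.1 j = 0 := by
  filter_upwards [h.ae_mem_boundary, h.ae_lateral_eq_zero] with q hq hlat
  by_cases hend : q.1.1 = 0 ∨ q.1.1 = T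
  · simp [normalSpace, hend]
  · obtain ⟨i, hi⟩ := mem_iUnion.1 hq.1
    have : q.1 ∈ boundaryPiece T Ω 2 := by
      fin_cases i
      · exact absurd (Or.inl hi.1) hend
      · exact absurd (Or.inr hi.1) hend
      · exact hi
    rw [hlat this, hβ, zero_mul]

section IBP

variable [IsFiniteMeasure μ] [IsFiniteMeasure μb]

/-- The time identity for arbitrary test functions `ψ(t, x)`. -/
lemma ibp_time (h : IsOccupationPair T Ω f y₀ Y Z μ μb) {β : ℝ → ℝ} (hβ : ContDiff ℝ 1 β)
    {ψ : TimeSpace n → ℝ} (hψ : ContDiff ℝ ∞ ψ) (hψc : HasCompactSupport ψ) :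
    ∫ q, (fderiv ℝ ψ q.1 (1, 0) * β q.2.1 + ψ q.1 * (q.2.2.1 * deriv β q.2.1)) ∂μ =
      ∫ q, ψ q.1 * (β q.2.1 * normalTime T q.1) ∂μb := by
  have hβ' := hβ.continuous_deriv le_rfl
  obtain ⟨A, hA0, -, hA, hAb⟩ := h.exists_bound (g := fun ξ => β ξ.1) (by fun_prop)
  obtain ⟨B, hB0, -, hB, -⟩ := h.exists_bound (g := fun ξ => ξ.2.1 * deriv β ξ.1) (by fun_prop)
  have key := ibpPairing_eq_zero (μ := μ) (ν := μb) (isCompact_closedCylinder h.isBounded)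
    (h.ae_mem.mono fun q hq => hq.1)
    (h.ae_mem_boundary.mono fun q hq => cylinderBoundary_subset h.pos.le hq.1)
    (a := fun q => β q.2.1) (b := fun q => q.2.2.1 * deriv β q.2.1)
    (c := fun q => β q.2.1 * normalTime T q.1) (A := max A B)
    (aestronglyMeasurable_val (g := fun ξ => β ξ.1) (by fun_prop))
    (aestronglyMeasurable_val (g := fun ξ => ξ.2.1 * deriv β ξ.1) (by fun_prop))
    ((aestronglyMeasurable_val (g := fun ξ => β ξ.1) (by fun_prop)).mul
      ((measurable_normalTime T).comp measurable_fst).aestronglyMeasurable)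
    (hA.mono fun q hq => hq.trans (le_max_left _ _)) (hB.mono fun q hq => hq.trans (le_max_right _ _))
    (hAb.mono fun q hq => by
      rw [abs_mul]
      exact (mul_le_mul hq (abs_normalTime_le T q.1) (abs_nonneg _) hA0).trans (by simp))
    (e := (1, 0)) (ℓ := ContinuousLinearMap.fst ℝ ℝ (Space n)) rfl ?_ hψ hψc
  · exact sub_eq_zero.1 key
  rintro R F ⟨φ, w, hφ, hw, hF⟩
  obtain ⟨Φ, hΦ, hΦ0, hΦd⟩ := exists_smooth_antiderivative hφ (-R)
  have hvs := contDiff_prod_coord hw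
  refine ⟨fun p => Φ p.1 * ∏ l, w l (p.2 l), ?_, fun p => ?_, fun p hp => ?_, ?_⟩
  · exact (hΦ.continuous.comp continuous_fst).mul (hvs.continuous.comp continuous_snd)
  · rw [hF]
    have : HasDerivAt (fun s : ℝ => Φ (p.1 + s)) (φ p.1) 0 :=
      HasDerivAt.comp_const_add p.1 0 (by simpa using hΦd p.1)
    simpa using this.mul_const (∏ l, w l (p.2 l))
  · have hp' : p.1 = -R := hp
    simp [hp', hΦ0]
  · have := h.identities.ibp_time Φ _ _ β hΦ
      (memH1WithTrace_of_contDiff h.isOpen h.isBounded hvs) hβ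
    rw [ibpPairing, ← this]
    have hd : deriv Φ = φ := funext fun t => (hΦd t).deriv
    simp only [hF, hd]
    congr 1 <;> refine integral_congr_ae (ae_of_all _ fun q => ?_) <;> simp only <;> ring

/-- The space identity for arbitrary test functions `ψ(t, x)`. -/
lemma ibp_space (h : IsOccupationPair T Ω f y₀ Y Z μ μb) {β : ℝ → ℝ} (hβ : ContDiff ℝ 1 β)
    (j : Fin n) {ψ : TimeSpace n → ℝ} (hψ : ContDiff ℝ ∞ ψ) (hψc : HasCompactSupport ψ) :
    ∫ q, (fderiv ℝ ψ q.1 (0, EuclideanSpace.single j 1) * β q.2.1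
        + ψ q.1 * (q.2.2.2 j * deriv β q.2.1)) ∂μ =
      ∫ q, ψ q.1 * (β q.2.1 * normalSpace T Ω q.1 j) ∂μb := by
  have hβ' := hβ.continuous_deriv le_rfl
  obtain ⟨A, hA0, -, hA, hAb⟩ := h.exists_bound (g := fun ξ => β ξ.1) (by fun_prop)
  obtain ⟨B, hB0, -, hB, -⟩ := h.exists_bound (g := fun ξ => ξ.2.2 j * deriv β ξ.1) (by fun_prop)
  have key := ibpPairing_eq_zero (μ := μ) (ν := μb) (isCompact_closedCylinder h.isBounded)
    (h.ae_mem.mono fun q hq => hq.1)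
    (h.ae_mem_boundary.mono fun q hq => cylinderBoundary_subset h.pos.le hq.1)
    (a := fun q => β q.2.1) (b := fun q => q.2.2.2 j * deriv β q.2.1)
    (c := fun q => β q.2.1 * normalSpace T Ω q.1 j) (A := max A B)
    (aestronglyMeasurable_val (g := fun ξ => β ξ.1) (by fun_prop))
    (aestronglyMeasurable_val (g := fun ξ => ξ.2.2 j * deriv β ξ.1) (by fun_prop))
    ((aestronglyMeasurable_val (g := fun ξ => β ξ.1) (by fun_prop)).mul
      (((EuclideanSpace.proj (𝕜 := ℝ) j).continuous.measurable.comp (measurable_normalSpace T)).comp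
        measurable_fst).aestronglyMeasurable)
    (hA.mono fun q hq => hq.trans (le_max_left _ _)) (hB.mono fun q hq => hq.trans (le_max_right _ _))
    (hAb.mono fun q hq => by
      rw [abs_mul]
      exact (mul_le_mul hq ((PiLp.norm_apply_le _ j).trans (norm_normalSpace_le T q.1))
        (abs_nonneg _) hA0).trans (by simp))
    (e := (0, EuclideanSpace.single j 1))
    (ℓ := (EuclideanSpace.proj j).comp (ContinuousLinearMap.snd ℝ ℝ (Space n))) (by simp) ?_ hψ hψc
  · exact sub_eq_zero.1 key
  rintro R F ⟨φ, w, hφ, hw, hF⟩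
  obtain ⟨W, hW, hW0, hWd⟩ := exists_smooth_antiderivative (hw j) (-R)
  have hu : ∀ l, ContDiff ℝ ∞ (Function.update w j W l) := by
    intro l
    by_cases hl : l = j
    · subst hl; simpa using hW
    · simpa [hl] using hw l
  have hvs := contDiff_prod_coord hu
  refine ⟨fun p => φ p.1 * ∏ l, Function.update w j W l (p.2 l), ?_, fun p => ?_, fun p hp => ?_, ?_⟩
  · exact (hφ.continuous.comp continuous_fst).mul (hvs.continuous.comp continuous_snd)
  · rw [hF]
    have := (hasDerivAt_prod_update hWd p.2).const_mul (φ p.1)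
    simpa using this
  · have hp' : p.2 j = -R := hp
    simp only [prod_update_eq, hp', hW0, zero_mul, mul_zero]
  · have := h.identities.ibp_space φ _ _ β hφ
      (memH1WithTrace_of_contDiff h.isOpen h.isBounded hvs) hβ j
    rw [ibpPairing, ← this]
    simp only [hF, gradient_prod_update_apply hw hW hWd]
    congr 1 <;> refine integral_congr_ae (ae_of_all _ fun q => ?_) <;> simp only <;> ring

end IBP

end IsOccupationPair

/-! ### Disintegration of the occupation measure -/

/-- Two probability measures on `ℝ × ℝ × ℝⁿ` that are carried by a compact set agree if they give the
same integrals to the absolute values of a dense sequence of continuous functions. -/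
lemma measure_eq_of_denseSeq {n : ℕ} {K : Set (Val n)} (hK : IsCompact K) {ρ ρ' : Measure (Val n)}
    [IsProbabilityMeasure ρ] [IsProbabilityMeasure ρ'] (hρ : ∀ᵐ ξ ∂ρ, ξ ∈ K)
    (hρ' : ∀ᵐ ξ ∂ρ', ξ ∈ K) {u : ℕ → C(Val n, ℝ)} (hu : DenseRange u)
    (h : ∀ k, ∫⁻ ξ, ENNReal.ofReal |u k ξ| ∂ρ = ∫⁻ ξ, ENNReal.ofReal |u k ξ| ∂ρ') : ρ = ρ' := by
  refine ext_of_forall_lintegral_eq_of_IsFiniteMeasure fun F => ?_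
  let F' : C(Val n, ℝ) := ⟨fun ξ => (F ξ : ℝ), by fun_prop⟩
  have happrox : ∀ ε : ℝ≥0, 0 < ε → ∃ k, ∀ ξ ∈ K, |u k ξ - F ξ| ≤ ε := by
    intro ε hε
    have h1 : TendstoUniformlyOn (fun (g : C(Val n, ℝ)) ξ => g ξ) F' (𝓝 F') K :=
      ContinuousMap.tendsto_iff_forall_isCompact_tendstoUniformlyOn.1
        (tendsto_id (α := C(Val n, ℝ)) (x := 𝓝 F')) K hK
    have h2 := Metric.tendstoUniformlyOn_iff.1 h1 ε hε
    obtain ⟨_, hg, k, rfl⟩ := mem_closure_iff_nhds.1 (hu F') _ h2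
    refine ⟨k, fun ξ hξ => ?_⟩
    have := hg ξ hξ
    rw [dist_comm, Real.dist_eq] at this
    exact this.le
  have hle : ∀ (ρ ρ' : Measure (Val n)) [IsProbabilityMeasure ρ] [IsProbabilityMeasure ρ'],
      (∀ᵐ ξ ∂ρ, ξ ∈ K) → (∀ᵐ ξ ∂ρ', ξ ∈ K) →
      (∀ k, ∫⁻ ξ, ENNReal.ofReal |u k ξ| ∂ρ = ∫⁻ ξ, ENNReal.ofReal |u k ξ| ∂ρ') →
      ∫⁻ ξ, F ξ ∂ρ ≤ ∫⁻ ξ, F ξ ∂ρ' := by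
    intro ρ ρ' _ _ hρ hρ' h
    refine ENNReal.le_of_forall_pos_le_add fun ε hε _ => ?_
    obtain ⟨k, hk⟩ := happrox (ε / 2) (half_pos hε)
    have e1 : ∀ ξ ∈ K, (F ξ : ℝ≥0∞) ≤ ENNReal.ofReal |u k ξ| + (ε / 2 : ℝ≥0) := by
      intro ξ hξ
      rw [← ENNReal.ofReal_coe_nnreal, ← ENNReal.ofReal_coe_nnreal (p := ε / 2),
        ← ENNReal.ofReal_add (abs_nonneg _) (NNReal.coe_nonneg (ε / 2))]
      refine ENNReal.ofReal_le_ofReal ?_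
      have := abs_le.1 (hk ξ hξ)
      linarith [le_abs_self (u k ξ)]
    have e2 : ∀ ξ ∈ K, ENNReal.ofReal |u k ξ| ≤ (F ξ : ℝ≥0∞) + (ε / 2 : ℝ≥0) := by
      intro ξ hξ
      rw [← ENNReal.ofReal_coe_nnreal, ← ENNReal.ofReal_coe_nnreal (p := ε / 2),
        ← ENNReal.ofReal_add (NNReal.coe_nonneg (F ξ)) (NNReal.coe_nonneg (ε / 2))]
      refine ENNReal.ofReal_le_ofReal ?_
      have h1 := abs_sub_abs_le_abs_sub (u k ξ) (F ξ)
      rw [abs_of_nonneg (NNReal.coe_nonneg (F ξ))] at h1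
      linarith [hk ξ hξ]
    calc ∫⁻ ξ, F ξ ∂ρ ≤ ∫⁻ ξ, (ENNReal.ofReal |u k ξ| + (ε / 2 : ℝ≥0)) ∂ρ :=
          lintegral_mono_ae (hρ.mono e1)
      _ = ∫⁻ ξ, ENNReal.ofReal |u k ξ| ∂ρ' + (ε / 2 : ℝ≥0) := by
          rw [lintegral_add_right _ measurable_const, lintegral_const, measure_univ, mul_one, h k]
      _ ≤ ∫⁻ ξ, ((F ξ : ℝ≥0∞) + (ε / 2 : ℝ≥0)) ∂ρ' + (ε / 2 : ℝ≥0) := by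
          gcongr ?_ + _
          exact lintegral_mono_ae (hρ'.mono e2)
      _ = ∫⁻ ξ, F ξ ∂ρ' + ε := by
          rw [lintegral_add_right _ measurable_const, lintegral_const, measure_univ, mul_one,
            add_assoc, ← ENNReal.coe_add, add_halves]
  exact le_antisymm (hle ρ ρ' hρ hρ' h) (hle ρ' ρ hρ' hρ fun k => (h k).symm)

namespace IsOccupationPair

open ProbabilityTheory

variable {n : ℕ} {T : ℝ} {Ω : Set (Space n)} {f : ℝ → Space n → ℝ → ℝ} {y₀ : Space n → ℝ}
  {Y : Set ℝ} {Z : Set (ℝ × Space n)} {μhat μb : Measure (TimeSpace n × Val n)}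

lemma restrict_closedCylinder (h : IsOccupationPair T Ω f y₀ Y Z μhat μb) :
    (volume.restrict (closedCylinder T Ω) : Measure (TimeSpace n)) =
      volume.restrict (Icc 0 T ×ˢ Ω) :=
  Measure.restrict_congr_set (h.lipschitz.Icc_prod_closure_ae_eq h.isOpen)

lemma measurableSet_Icc_prod (h : IsOccupationPair T Ω f y₀ Y Z μhat μb) :
    MeasurableSet (Icc 0 T ×ˢ Ω : Set (TimeSpace n)) :=
  measurableSet_Icc.prod h.isOpen.measurableSet

variable [IsFiniteMeasure μhat] [IsFiniteMeasure μb]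

lemma fst_eq (h : IsOccupationPair T Ω f y₀ Y Z μhat μb) :
    μhat.fst = volume.restrict (Icc 0 T ×ˢ Ω) := by
  rw [← h.restrict_closedCylinder, ← h.map_fst, Measure.fst]

/-- The conditional distribution of the values. -/
lemma exists_kernel (h : IsOccupationPair T Ω f y₀ Y Z μhat μb) :
    ∃ κ : Kernel (TimeSpace n) (Val n), IsMarkovKernel κ ∧
      μhat = (volume.restrict (Icc 0 T ×ˢ Ω)).compProd κ ∧
      ∀ᵐ p ∂volume.restrict (Icc 0 T ×ˢ Ω), ∀ᵐ ξ ∂κ p, ξ ∈ Y ×ˢ Z := by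
  have hfin := isFiniteMeasure_restrict_prod (T := T) h.isBounded
  have hdis : μhat = (volume.restrict (Icc 0 T ×ˢ Ω)).compProd μhat.condKernel := by
    rw [← h.fst_eq]; exact (μhat.disintegrate _).symm
  refine ⟨μhat.condKernel, inferInstance, hdis, ?_⟩
  refine Measure.ae_ae_of_ae_compProd (p := fun q => q.2 ∈ Y ×ˢ Z) ?_
  rw [← hdis]
  exact h.ae_mem.mono fun q hq => hq.2

/-- Existence of the Young measure: modify the conditional distribution on a null set. -/
lemma exists_youngMeasure (h : IsOccupationPair T Ω f y₀ Y Z μhat μb) :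
    ∃ μ, IsYoungMeasure T Ω (Y ×ˢ Z) μ ∧ IsDisintegration T Ω μhat μ := by
  obtain ⟨κ, hκ, hdis, hκK⟩ := h.exists_kernel
  have hfin := isFiniteMeasure_restrict_prod (T := T) h.isBounded
  have hK : MeasurableSet (Y ×ˢ Z) := h.isCompact_values.measurableSet
  -- a probability measure on `Y × Z` is needed at the exceptional points
  obtain ⟨ρ, hρ⟩ : ∃ ρ : Measure (Val n), ∀ p ∈ (Icc 0 T ×ˢ Ω : Set (TimeSpace n)),
      IsProbabilityMeasure ρ ∧ ρ (Y ×ˢ Z)ᶜ = 0 := by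
    rcases (Y ×ˢ Z).eq_empty_or_nonempty with hem | ⟨ξ, hξ⟩
    · refine ⟨0, fun p hp => ?_⟩
      have h0 : μhat = 0 := by
        rw [← Measure.measure_univ_eq_zero]
        have := h.supp
        rwa [hem, prod_empty, compl_empty] at this
      have h1 : (volume.restrict (Icc 0 T ×ˢ Ω) : Measure (TimeSpace n)) = 0 := by
        rw [← h.fst_eq, h0, Measure.fst_zero]
      have h2 : volume (Ioo 0 T ×ˢ Ω : Set (TimeSpace n)) = 0 := by
        rw [measure_congr Ioo_prod_ae_eq_Icc_prod, ← Measure.restrict_apply_univ, h1]; simp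
      have h3 : (Ioo 0 T ×ˢ Ω : Set (TimeSpace n)).Nonempty :=
        (nonempty_Ioo.2 h.pos).prod ⟨p.2, hp.2⟩
      exact absurd h2 ((isOpen_Ioo.prod h.isOpen).measure_pos volume h3).ne'
    · exact ⟨Measure.dirac ξ, fun p _ => ⟨inferInstance, by
        rw [Measure.dirac_apply' _ hK.compl]; simp [hξ]⟩⟩
  classical
  set μ : TimeSpace n → Measure (Val n) := fun p => if κ p (Y ×ˢ Z)ᶜ = 0 then κ p else ρ with hμ
  have hμκ : ∀ᵐ p ∂volume.restrict (Icc 0 T ×ˢ Ω), μ p = κ p :=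
    hκK.mono fun p hp => if_pos hp
  refine ⟨μ, ⟨fun p hp => ?_, fun p hp => ?_, fun g hg _ => ?_⟩, fun F hF => ?_⟩
  · by_cases hp' : κ p (Y ×ˢ Z)ᶜ = 0
    · simp only [hμ, if_pos hp']; infer_instance
    · simp only [hμ, if_neg hp']; exact (hρ p hp).1
  · by_cases hp' : κ p (Y ×ˢ Z)ᶜ = 0
    · simp only [hμ, if_pos hp']; exact hp'
    · simp only [hμ, if_neg hp']; exact (hρ p hp).2
  · have hgm : Measurable ((Y ×ˢ Z).piecewise g fun _ => 0) :=
      hg.measurable_piecewise continuous_const.continuousOn hK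
    have := (hgm.stronglyMeasurable.integral_kernel (κ := κ)).aestronglyMeasurable
      (μ := volume.restrict (Icc 0 T ×ˢ Ω))
    refine this.congr ?_
    filter_upwards [hμκ] with p hp
    rw [hp, ← integral_indicator hK]
    exact integral_congr_ae (ae_of_all _ fun ξ => by rw [← piecewise_eq_indicator]; rfl)
  · rw [hdis, Measure.lintegral_compProd hF, h.restrict_closedCylinder]
    exact lintegral_congr_ae (hμκ.mono fun p hp => by simp only [hp])

/-- Uniqueness: every Young measure that disintegrates the occupation measure is almost everywhere
given by one measurable kernel. -/
lemma exists_kernel_ae_eq (h : IsOccupationPair T Ω f y₀ Y Z μhat μb)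
    {μ : TimeSpace n → Measure (Val n)} (hμ : IsYoungMeasure T Ω (Y ×ˢ Z) μ)
    (hdμ : IsDisintegration T Ω μhat μ) :
    ∃ κ : Kernel (TimeSpace n) (Val n), IsMarkovKernel κ ∧
      μhat = (volume.restrict (Icc 0 T ×ˢ Ω)).compProd κ ∧
      ∀ᵐ p ∂volume.restrict (Icc 0 T ×ˢ Ω), μ p = κ p := by
  obtain ⟨κ, hκ, hdis, hκK⟩ := h.exists_kernel
  refine ⟨κ, hκ, hdis, ?_⟩
  have hfin := isFiniteMeasure_restrict_prod (T := T) h.isBounded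
  have hmem := ae_restrict_mem (μ := volume) h.measurableSet_Icc_prod
  have hK : MeasurableSet (Y ×ˢ Z) := h.isCompact_values.measurableSet
  have htest : ∀ g : C(Val n, ℝ), ∀ᵐ p ∂volume.restrict (Icc 0 T ×ˢ Ω),
      ∫⁻ ξ, ENNReal.ofReal |g ξ| ∂μ p = ∫⁻ ξ, ENNReal.ofReal |g ξ| ∂κ p := by
    intro g
    have hgm : Measurable fun ξ => ENNReal.ofReal |g ξ| := by fun_prop
    obtain ⟨A, -, hA, -⟩ := h.exists_bound g.continuous
    refine ae_eq_of_forall_setLIntegral_eq_of_sigmaFinite₀ ?_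
      hgm.lintegral_kernel.aemeasurable fun s hs _ => ?_
    · have h1 := (hμ.measurable (fun ξ => |g ξ|) (by fun_prop)
        ⟨A, fun ξ hξ => by rw [abs_abs]; exact hA ξ hξ⟩).aemeasurable.ennreal_ofReal
      refine h1.congr ?_
      filter_upwards [hmem] with p hp
      have := hμ.prob p hp
      have hae : ∀ᵐ ξ ∂μ p, ξ ∈ Y ×ˢ Z := hμ.supp p hp
      rw [Measure.restrict_eq_self_of_ae_mem hae,
        ofReal_integral_eq_lintegral_ofReal _ (ae_of_all _ fun ξ => abs_nonneg _)]
      refine Integrable.of_bound (by fun_prop) A (hae.mono fun ξ hξ => ?_)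
      rw [Real.norm_eq_abs, abs_abs]
      exact hA ξ hξ
    · have hF : Measurable fun q : TimeSpace n × Val n =>
          s.indicator (fun _ => (1 : ℝ≥0∞)) q.1 * ENNReal.ofReal |g q.2| :=
        ((measurable_const.indicator hs).comp measurable_fst).mul (hgm.comp measurable_snd)
      have e1 := hdμ _ hF
      have e2 : ∫⁻ q, s.indicator (fun _ => (1 : ℝ≥0∞)) q.1 * ENNReal.ofReal |g q.2| ∂μhat =
          ∫⁻ p in Icc 0 T ×ˢ Ω, ∫⁻ ξ, s.indicator (fun _ => (1 : ℝ≥0∞)) p *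
            ENNReal.ofReal |g ξ| ∂κ p := by
        conv_lhs => rw [hdis]
        rw [Measure.lintegral_compProd hF]
      rw [e2, h.restrict_closedCylinder] at e1
      simp only [lintegral_const_mul _ hgm] at e1
      rw [← lintegral_indicator hs, ← lintegral_indicator hs]
      convert! e1.symm using 3 with p p
      · by_cases hp : p ∈ s <;> simp [hp]
      · by_cases hp : p ∈ s <;> simp [hp]
  have hall := ae_all_iff.2 fun k => htest (TopologicalSpace.denseSeq C(Val n, ℝ) k)
  filter_upwards [hmem, hκK, hall] with p hp hp' hpk
  have := hμ.prob p hp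
  exact measure_eq_of_denseSeq h.isCompact_values (hμ.supp p hp) hp'
    (TopologicalSpace.denseRange_denseSeq _) hpk

section Disintegration

variable {μ : TimeSpace n → Measure (Val n)}

lemma integral_eq (h : IsOccupationPair T Ω f y₀ Y Z μhat μb)
    (hμ : IsYoungMeasure T Ω (Y ×ˢ Z) μ) (hdμ : IsDisintegration T Ω μhat μ)
    {F : TimeSpace n × Val n → ℝ} (hF : Integrable F μhat) :
    ∫ q, F q ∂μhat = ∫ p in Icc 0 T ×ˢ Ω, ∫ ξ, F (p, ξ) ∂μ p := by
  obtain ⟨κ, hκ, hdis, hae⟩ := h.exists_kernel_ae_eq hμ hdμ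
  have hfin := isFiniteMeasure_restrict_prod (T := T) h.isBounded
  rw [hdis] at hF ⊢
  rw [Measure.integral_compProd hF]
  exact integral_congr_ae (hae.mono fun p hp => by simp only [hp])

lemma integrable_integral (h : IsOccupationPair T Ω f y₀ Y Z μhat μb)
    (hμ : IsYoungMeasure T Ω (Y ×ˢ Z) μ) (hdμ : IsDisintegration T Ω μhat μ)
    {E : Type*} [NormedAddCommGroup E] [NormedSpace ℝ E]
    {F : TimeSpace n × Val n → E} (hF : Integrable F μhat) :
    Integrable (fun p => ∫ ξ, F (p, ξ) ∂μ p) (volume.restrict (Icc 0 T ×ˢ Ω)) := by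
  obtain ⟨κ, hκ, hdis, hae⟩ := h.exists_kernel_ae_eq hμ hdμ
  have hfin := isFiniteMeasure_restrict_prod (T := T) h.isBounded
  rw [hdis] at hF
  refine (Integrable.integral_compProd hF).congr ?_
  exact hae.mono fun p hp => by simp only [hp, Kernel.prodMkLeft_apply]

end Disintegration

/-- A property of almost every `(t, x)` holds almost everywhere for the occupation measure. -/
lemma ae_of_ae_fst (h : IsOccupationPair T Ω f y₀ Y Z μhat μb) {P : TimeSpace n → Prop}
    (hP : ∀ᵐ p ∂volume.restrict (Icc 0 T ×ˢ Ω), P p) : ∀ᵐ q ∂μhat, P q.1 := by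
  rw [← h.fst_eq, Measure.fst] at hP
  exact ae_of_ae_map measurable_fst.aemeasurable hP

end IsOccupationPair

/-! ### Joint measurability of the reaction term -/

/-- A reaction term coincides, for almost every `(t, x)`, with a jointly measurable function. -/
lemma IsReactionTerm.exists_measurable {n : ℕ} {T : ℝ} {Ω : Set (Space n)}
    {f : ℝ → Space n → ℝ → ℝ} (hf : IsReactionTerm T Ω f) :
    ∃ F : ℝ × TimeSpace n → ℝ, Measurable F ∧
      ∀ᵐ p ∂volume.restrict (Icc 0 T ×ˢ Ω), ∀ y, f p.1 p.2 y = F (y, p) := by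
  have hae : ∀ᵐ p : TimeSpace n ∂volume.restrict (Icc 0 T ×ˢ Ω), Continuous (f p.1 p.2) ∧
      ∀ r : ℚ, f p.1 p.2 r = (hf.measurable r).mk _ p :=
    hf.continuous.and (ae_all_iff.2 fun r : ℚ => (hf.measurable r).ae_eq_mk)
  -- `G` is a measurable set of full measure; `u` is `f` on `G` and zero elsewhere
  obtain ⟨G, hG, hGm, hGp⟩ := hae.exists_measurable_mem
  let u : ℝ → TimeSpace n → ℝ := fun y => G.indicator fun p => f p.1 p.2 y
  have hcont : ∀ p, Continuous fun y => u y p := by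
    intro p
    by_cases hp : p ∈ G
    · simpa [u, hp] using (hGp p hp).1
    · simpa [u, hp] using continuous_const
  have hrat : ∀ r : ℚ, Measurable (u r) := by
    intro r
    have : u r = G.indicator ((hf.measurable r).mk _) := by
      funext p
      by_cases hp : p ∈ G
      · simp only [u, indicator_of_mem hp]; exact (hGp p hp).2 r
      · simp [u, hp]
    rw [this]
    exact (hf.measurable r).stronglyMeasurable_mk.measurable.indicator hGm
  have hmeas : ∀ y, Measurable (u y) := by
    intro y
    obtain ⟨r, -, hr⟩ := Real.exists_seq_rat_strictMono_tendsto y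
    exact measurable_of_tendsto_metrizable (fun k => hrat (r k))
      (tendsto_pi_nhds.2 fun p => ((hcont p).tendsto y).comp hr.2)
  refine ⟨Function.uncurry u, measurable_uncurry_of_continuous_of_measurable hcont hmeas, ?_⟩
  filter_upwards [hG] with p hp y
  simp [Function.uncurry, u, hp]

/-! ### Functions with bounded weak derivatives are Lipschitz -/

section Lipschitz

open scoped Convolution

variable {E : Type*} [NormedAddCommGroup E] [NormedSpace ℝ E] [FiniteDimensional ℝ E]
  [MeasurableSpace E] [BorelSpace E] {μ : Measure E} [μ.IsAddHaarMeasure]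

/-- The mollification of a function with weak derivatives bounded by `M` on `U` has derivatives
bounded by `M` at the points that are sufficiently far from the complement of `U`. -/
lemma exists_hasFDerivAt_mollification {U : Set E} {u : E → ℝ} (hu : LocallyIntegrable u μ) {M : ℝ}
    (hM : 0 ≤ M) (h : ∀ ψ, IsTestFunction U ψ → ∀ e,
      |∫ x, fderiv ℝ ψ x e * u x ∂μ| ≤ M * ‖e‖ * ∫ x, |ψ x| ∂μ)
    (φ : ContDiffBump (0 : E)) {x₀ : E} (hx₀ : Metric.closedBall x₀ φ.rOut ⊆ U) :
    ∃ D : E →L[ℝ] ℝ, ‖D‖ ≤ M ∧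
      HasFDerivAt (φ.normed μ ⋆[ContinuousLinearMap.lsmul ℝ ℝ, μ] u) D x₀ := by
  set N := φ.normed μ with hN
  have hNc : HasCompactSupport N := φ.hasCompactSupport_normed
  have hNs : ContDiff ℝ ∞ N := φ.contDiff_normed
  rw [← convolution_flip]
  have hd := hNc.hasFDerivAt_convolution_right (ContinuousLinearMap.lsmul ℝ ℝ).flip hu
    (hNs.of_le (by norm_num)) x₀
  refine ⟨_, ContinuousLinearMap.opNorm_le_bound _ hM fun e => ?_, hd⟩
  rw [convolution_precompR_apply _ hu (hNc.fderiv ℝ) (hNs.continuous_fderiv (by simp)),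
    convolution_def]
  -- the derivative is the pairing of `u` with the derivative of a reflected bump
  set ψ : E → ℝ := fun t => N (x₀ - t) with hψ
  have hψs : ContDiff ℝ ∞ ψ := hNs.comp (contDiff_const.sub contDiff_id)
  have hψsupp : Function.support ψ ⊆ Metric.closedBall x₀ φ.rOut := by
    intro t ht
    have : x₀ - t ∈ Function.support N := ht
    rw [hN, φ.support_normed_eq, mem_ball_zero_iff] at this
    rw [Metric.mem_closedBall, dist_comm, dist_eq_norm]
    exact this.le
  have hψt : tsupport ψ ⊆ Metric.closedBall x₀ φ.rOut :=
    closure_minimal hψsupp Metric.isClosed_closedBall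
  have hψtest : IsTestFunction U ψ :=
    ⟨hψs, HasCompactSupport.intro (isCompact_closedBall x₀ φ.rOut) fun t ht => by
      by_contra hne; exact ht (hψsupp hne), hψt.trans hx₀⟩
  have hfd : ∀ t, fderiv ℝ ψ t e = -fderiv ℝ N (x₀ - t) e := by
    intro t
    have h1 : HasFDerivAt (fun t : E => x₀ - t) (-ContinuousLinearMap.id ℝ E) t :=
      (hasFDerivAt_id t).const_sub x₀
    have h2 := ((hNs.differentiable (by simp)) (x₀ - t)).hasFDerivAt.comp t h1
    have h3 : fderiv ℝ ψ t = _ := h2.fderiv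
    rw [h3]; simp
  have hint : ∫ x, |ψ x| ∂μ = 1 := by
    have : ∀ x, |ψ x| = N (x₀ - x) := fun x => abs_of_nonneg (φ.nonneg_normed _)
    simp only [this]
    rw [integral_sub_left_eq_self N μ x₀]
    exact φ.integral_normed
  have key := h ψ hψtest e
  rw [hint, mul_one] at key
  simp only [hfd, neg_mul, integral_neg, abs_neg] at key
  simpa [mul_comm] using key

/-- A function whose weak derivatives are bounded by `M` on a convex open set coincides there almost
everywhere with an `M`-Lipschitz function: the mollifications are `M`-Lipschitz and converge
almost everywhere. -/
lemma exists_lipschitzWith_ae_eq {U : Set E} (hUo : IsOpen U) (hUc : Convex ℝ U) {u : E → ℝ}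
    (hu : LocallyIntegrable u μ) {M : ℝ≥0}
    (h : ∀ ψ, IsTestFunction U ψ → ∀ e,
      |∫ x, fderiv ℝ ψ x e * u x ∂μ| ≤ M * ‖e‖ * ∫ x, |ψ x| ∂μ) :
    ∃ C : E → ℝ, LipschitzWith M C ∧ ∀ᵐ x ∂μ, x ∈ U → u x = C x := by
  let φ : ℕ → ContDiffBump (0 : E) := fun k =>
    ⟨1 / ((k : ℝ) + 1) / 2, 1 / ((k : ℝ) + 1), by positivity, half_lt_self (by positivity)⟩
  have hφ : Tendsto (fun k => (φ k).rOut) atTop (𝓝 0) := tendsto_one_div_add_atTop_nhds_zero_nat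
  have hae := ContDiffBump.ae_convolution_tendsto_right_of_locallyIntegrable (μ := μ) (K := 2) hφ
    (Eventually.of_forall fun k => by
      change 1 / ((k : ℝ) + 1) ≤ 2 * (1 / ((k : ℝ) + 1) / 2); linarith) hu
  set G := {x | Tendsto (fun k => ((φ k).normed μ ⋆[ContinuousLinearMap.lsmul ℝ ℝ, μ] u) x) atTop
    (𝓝 (u x))} with hG
  have hlip : LipschitzOnWith M u (U ∩ G) := by
    refine LipschitzOnWith.of_dist_le_mul fun x hx y hy => ?_
    have hseg : segment ℝ y x ⊆ U := hUc.segment_subset hy.1 hx.1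
    have hsegc : IsCompact (segment ℝ y x) := by
      rw [segment_eq_image_lineMap]
      exact isCompact_Icc.image (AffineMap.lineMap_continuous)
    obtain ⟨δ, hδ, hδU⟩ := hsegc.exists_cthickening_subset_open hUo hseg
    have hev : ∀ᶠ k in atTop,
        dist (((φ k).normed μ ⋆[ContinuousLinearMap.lsmul ℝ ℝ, μ] u) x)
          (((φ k).normed μ ⋆[ContinuousLinearMap.lsmul ℝ ℝ, μ] u) y) ≤ M * dist x y := by
      filter_upwards [hφ.eventually_le_const hδ] with k hk
      have hD : ∀ z ∈ segment ℝ y x, ∃ D : E →L[ℝ] ℝ, ‖D‖ ≤ M ∧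
          HasFDerivAt ((φ k).normed μ ⋆[ContinuousLinearMap.lsmul ℝ ℝ, μ] u) D z := fun z hz =>
        exists_hasFDerivAt_mollification hu M.2 h (φ k)
          (((Metric.closedBall_subset_closedBall hk).trans
            (Metric.closedBall_subset_cthickening hz δ)).trans hδU)
      choose! D hDM hDd using hD
      rw [dist_eq_norm, dist_eq_norm]
      exact (convex_segment y x).norm_image_sub_le_of_norm_hasFDerivWithin_le
        (fun z hz => (hDd z hz).hasFDerivWithinAt) hDM (left_mem_segment ℝ y x)
        (right_mem_segment ℝ y x)
    exact le_of_tendsto (hx.2.dist hy.2) hev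
  obtain ⟨C, hC, hCu⟩ := hlip.extend_real
  exact ⟨C, hC, hae.mono fun x hx hxU => hCu ⟨hxU, hx⟩⟩

end Lipschitz

/-! ### Moments of the Young measure -/

section Derivatives

variable {n : ℕ}

lemma timeDeriv_eq_fderiv {ψ : TimeSpace n → ℝ} (hψ : Differentiable ℝ ψ) (p : TimeSpace n) :
    timeDeriv ψ p = fderiv ℝ ψ p (1, 0) := by
  have h1 : HasDerivAt (fun s : ℝ => (s, p.2)) ((1, 0) : TimeSpace n) p.1 :=
    (hasDerivAt_id p.1).prodMk (hasDerivAt_const _ _)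
  exact ((hψ (p.1, p.2)).hasFDerivAt.comp_hasDerivAt p.1 h1).deriv

lemma inner_spaceGrad {ψ : TimeSpace n → ℝ} (hψ : Differentiable ℝ ψ) (p : TimeSpace n)
    (e : Space n) : inner ℝ (spaceGrad ψ p) e = fderiv ℝ ψ p (0, e) := by
  rw [spaceGrad, inner_gradient]
  have h1 : HasFDerivAt (fun x : Space n => (p.1, x)) (ContinuousLinearMap.inr ℝ ℝ (Space n)) p.2 :=
    hasFDerivAt_prodMk_right p.1 p.2
  have h2 := (hψ (p.1, p.2)).hasFDerivAt.comp p.2 h1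
  have h3 : fderiv ℝ (fun x => ψ (p.1, x)) p.2 = _ := h2.fderiv
  rw [h3]
  simp

lemma continuous_spaceGrad {ψ : TimeSpace n → ℝ} (hψ : ContDiff ℝ ∞ ψ) :
    Continuous (spaceGrad ψ) := by
  have hd := hψ.continuous_fderiv (by simp)
  have : spaceGrad ψ = fun p => (InnerProductSpace.toDual ℝ (Space n)).symm
      ((fderiv ℝ ψ p).comp (ContinuousLinearMap.inr ℝ ℝ (Space n))) := by
    funext p
    refine ext_inner_right ℝ fun e => ?_
    rw [inner_spaceGrad (hψ.differentiable (by simp)), InnerProductSpace.toDual_symm_apply]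
    simp
  rw [this]
  exact (LinearIsometryEquiv.continuous _).comp (hd.clm_comp continuous_const)

lemma timeSpace_eq_sum (e : TimeSpace n) :
    e = e.1 • ((1, 0) : TimeSpace n) +
      ∑ j, e.2 j • ((0, EuclideanSpace.single j 1) : TimeSpace n) := by
  refine Prod.ext ?_ ?_
  · simp [Prod.fst_sum]
  · refine PiLp.ext fun i => ?_
    simp [Prod.snd_sum, Finset.sum_apply, Pi.single_apply]

end Derivatives

namespace IsOccupationPair

variable {n : ℕ} {T : ℝ} {Ω : Set (Space n)} {f : ℝ → Space n → ℝ → ℝ} {y₀ : Space n → ℝ}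
  {Y : Set ℝ} {Z : Set (ℝ × Space n)} {μhat μb : Measure (TimeSpace n × Val n)}
  {μ : TimeSpace n → Measure (Val n)}

lemma integrable_of_continuous (h : IsOccupationPair T Ω f y₀ Y Z μhat μb) {F : TimeSpace n → ℝ}
    (hF : Continuous F) : Integrable F (volume.restrict (Icc 0 T ×ˢ Ω)) := by
  rw [← h.restrict_closedCylinder]
  exact hF.continuousOn.integrableOn_compact (isCompact_closedCylinder h.isBounded)

/-- Continuous functions of the values are integrable for each of the measures of the family. -/
lemma integrable_val (h : IsOccupationPair T Ω f y₀ Y Z μhat μb)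
    (hμ : IsYoungMeasure T Ω (Y ×ˢ Z) μ) {p : TimeSpace n} (hp : p ∈ Icc 0 T ×ˢ Ω)
    {E : Type*} [NormedAddCommGroup E] [SecondCountableTopology E] [MeasurableSpace E]
    [BorelSpace E] {g : Val n → E} (hg : Continuous g) : Integrable g (μ p) := by
  have := hμ.prob p hp
  obtain ⟨A, hA⟩ := h.isCompact_values.exists_bound_of_continuousOn hg.continuousOn
  have hae : ∀ᵐ ξ ∂μ p, ξ ∈ Y ×ˢ Z := hμ.supp p hp
  exact Integrable.of_bound hg.aestronglyMeasurable A (hae.mono hA)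

variable [IsFiniteMeasure μhat] [IsFiniteMeasure μb]

lemma integrable_mul (h : IsOccupationPair T Ω f y₀ Y Z μhat μb) {F : TimeSpace n → ℝ}
    (hF : Integrable F (volume.restrict (Icc 0 T ×ˢ Ω))) {a : TimeSpace n × Val n → ℝ}
    (ha : AEStronglyMeasurable a μhat) {A : ℝ} (hA : ∀ᵐ q ∂μhat, |a q| ≤ A) :
    Integrable (fun q => F q.1 * a q) μhat := by
  have h1 : Integrable (fun q : TimeSpace n × Val n => F q.1) μhat := by
    rw [← h.fst_eq, Measure.fst] at hF
    exact (integrable_map_measure hF.aestronglyMeasurable measurable_fst.aemeasurable).1 hF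
  exact h1.mul_bdd ha hA

lemma integrable_mul_val (h : IsOccupationPair T Ω f y₀ Y Z μhat μb) {F : TimeSpace n → ℝ}
    (hF : Integrable F (volume.restrict (Icc 0 T ×ˢ Ω))) {g : Val n → ℝ} (hg : Continuous g) :
    Integrable (fun q => F q.1 * g q.2) μhat := by
  obtain ⟨A, -, -, hA, -⟩ := h.exists_bound hg
  exact h.integrable_mul hF (aestronglyMeasurable_val hg) hA

/-- The directional form of the integration-by-parts formulas, when the boundary terms vanish. -/
lemma ibp_direction (h : IsOccupationPair T Ω f y₀ Y Z μhat μb) {β : ℝ → ℝ}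
    (hβ : ContDiff ℝ 1 β) {ψ : TimeSpace n → ℝ} (hψ : ContDiff ℝ ∞ ψ) (hψc : HasCompactSupport ψ)
    (h0 : ∀ p : TimeSpace n, p.1 = 0 ∨ p.1 = T → ψ p = 0)
    (hlat : β 0 = 0 ∨ ∀ p ∈ cylinderBoundary T Ω, ψ p = 0) (e : TimeSpace n) :
    ∫ q, fderiv ℝ ψ q.1 e * β q.2.1 ∂μhat =
      -∫ q, ψ q.1 * ((e.1 * q.2.2.1 + inner ℝ e.2 q.2.2.2) * deriv β q.2.1) ∂μhat := by
  have hβ' := hβ.continuous_deriv le_rfl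
  have hψ' : ∀ e, Continuous fun p => fderiv ℝ ψ p e := fun e =>
    (hψ.continuous_fderiv (by simp)).clm_apply continuous_const
  have iψ := h.integrable_of_continuous hψ.continuous
  have hβc := hβ.continuous
  have i1 : ∀ e, Integrable (fun q : TimeSpace n × Val n => fderiv ℝ ψ q.1 e * β q.2.1) μhat :=
    fun e => h.integrable_mul_val (h.integrable_of_continuous (hψ' e)) (g := fun ξ => β ξ.1)
      (by fun_prop)
  have it : Integrable (fun q : TimeSpace n × Val n => ψ q.1 * (q.2.2.1 * deriv β q.2.1)) μhat :=
    h.integrable_mul_val iψ (g := fun ξ => ξ.2.1 * deriv β ξ.1) (by fun_prop)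
  have ix : ∀ j, Integrable (fun q : TimeSpace n × Val n =>
      ψ q.1 * (q.2.2.2 j * deriv β q.2.1)) μhat := fun j =>
    h.integrable_mul_val iψ (g := fun ξ => ξ.2.2 j * deriv β ξ.1) (by fun_prop)
  have et : ∫ q, fderiv ℝ ψ q.1 (1, 0) * β q.2.1 ∂μhat =
      -∫ q, ψ q.1 * (q.2.2.1 * deriv β q.2.1) ∂μhat := by
    have := h.ibp_time hβ hψ hψc
    rw [integral_add (i1 _) it] at this
    rw [← add_eq_zero_iff_eq_neg, this]
    refine integral_eq_zero_of_ae (ae_of_all _ fun q => ?_)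
    by_cases hq : q.1.1 = 0 ∨ q.1.1 = T
    · simp [h0 _ hq]
    · rw [not_or] at hq
      simp [normalTime, hq.1, hq.2]
  have ex : ∀ j, ∫ q, fderiv ℝ ψ q.1 (0, EuclideanSpace.single j 1) * β q.2.1 ∂μhat =
      -∫ q, ψ q.1 * (q.2.2.2 j * deriv β q.2.1) ∂μhat := by
    intro j
    have := h.ibp_space hβ j hψ hψc
    rw [integral_add (i1 _) (ix j)] at this
    rw [← add_eq_zero_iff_eq_neg, this]
    refine integral_eq_zero_of_ae ?_
    rcases hlat with hβ0 | hψ0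
    · filter_upwards [h.normalSpace_mul_eq_zero hβ0 j] with q hq
      rw [hq]; simp
    · filter_upwards [h.ae_mem_boundary] with q hq
      rw [hψ0 _ hq.1]; simp
  have hd : ∀ q : TimeSpace n × Val n, fderiv ℝ ψ q.1 e * β q.2.1 =
      e.1 * (fderiv ℝ ψ q.1 (1, 0) * β q.2.1) +
        ∑ j, e.2 j * (fderiv ℝ ψ q.1 (0, EuclideanSpace.single j 1) * β q.2.1) := by
    intro q
    conv_lhs => rw [timeSpace_eq_sum e]
    simp only [map_add, map_sum, map_smul, smul_eq_mul, add_mul, Finset.sum_mul, mul_assoc]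
  have hr : ∀ q : TimeSpace n × Val n,
      ψ q.1 * ((e.1 * q.2.2.1 + inner ℝ e.2 q.2.2.2) * deriv β q.2.1) =
        e.1 * (ψ q.1 * (q.2.2.1 * deriv β q.2.1)) +
          ∑ j, e.2 j * (ψ q.1 * (q.2.2.2 j * deriv β q.2.1)) := by
    intro q
    simp only [PiLp.inner_apply, add_mul, mul_add, Finset.sum_mul, Finset.mul_sum,
      RCLike.inner_apply, conj_trivial]
    congr 1
    · ring
    · exact Finset.sum_congr rfl fun j _ => by ring
  simp only [hd, hr]
  rw [integral_add ((i1 _).const_mul _) (integrable_finsetSum _ fun j _ => (i1 _).const_mul _),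
    integral_add (it.const_mul _) (integrable_finsetSum _ fun j _ => (ix j).const_mul _),
    integral_finsetSum _ fun j _ => (i1 _).const_mul _,
    integral_finsetSum _ fun j _ => (ix j).const_mul _]
  simp only [integral_const_mul, et, ex, mul_neg, Finset.sum_neg_distrib]
  ring

lemma integral_mul_eq (h : IsOccupationPair T Ω f y₀ Y Z μhat μb)
    (hμ : IsYoungMeasure T Ω (Y ×ˢ Z) μ) (hdμ : IsDisintegration T Ω μhat μ) {F : TimeSpace n → ℝ}
    (hF : Integrable F (volume.restrict (Icc 0 T ×ˢ Ω))) {g : Val n → ℝ} (hg : Continuous g) :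
    ∫ q, F q.1 * g q.2 ∂μhat = ∫ p in Icc 0 T ×ˢ Ω, F p * ∫ ξ, g ξ ∂μ p := by
  rw [h.integral_eq hμ hdμ (h.integrable_mul_val hF hg)]
  simp only [integral_const_mul]

/-- Moments of continuous functions are bounded, hence in every `L^p`. -/
lemma memLp_moment (h : IsOccupationPair T Ω f y₀ Y Z μhat μb)
    (hμ : IsYoungMeasure T Ω (Y ×ˢ Z) μ) (hdμ : IsDisintegration T Ω μhat μ)
    {E : Type*} [NormedAddCommGroup E] [NormedSpace ℝ E] [SecondCountableTopology E]
    [MeasurableSpace E] [BorelSpace E] {g : Val n → E} (hg : Continuous g) (p : ℝ≥0∞) :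
    MemLp (fun p => ∫ ξ, g ξ ∂μ p) p (volume.restrict (Icc 0 T ×ˢ Ω)) := by
  have hfin := isFiniteMeasure_restrict_prod (T := T) h.isBounded
  obtain ⟨A, hA⟩ := h.isCompact_values.exists_bound_of_continuousOn hg.continuousOn
  have hint : Integrable (fun q : TimeSpace n × Val n => g q.2) μhat :=
    Integrable.of_bound (hg.measurable.comp measurable_snd).aestronglyMeasurable A
      (h.ae_mem.mono fun q hq => hA _ hq.2)
  refine MemLp.of_bound (h.integrable_integral hμ hdμ hint).aestronglyMeasurable A ?_
  filter_upwards [ae_restrict_mem h.measurableSet_Icc_prod] with p hp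
  have := hμ.prob p hp
  have hae : ∀ᵐ ξ ∂μ p, ξ ∈ Y ×ˢ Z := hμ.supp p hp
  simpa using norm_integral_le_of_norm_le_const (hae.mono hA)

lemma restrict_Ioo_prod : (volume.restrict (Ioo 0 T ×ˢ Ω) : Measure (TimeSpace n)) =
    volume.restrict (Icc 0 T ×ˢ Ω) :=
  Measure.restrict_congr_set Ioo_prod_ae_eq_Icc_prod

lemma hasFiniteMoments (h : IsOccupationPair T Ω f y₀ Y Z μhat μb)
    (hμ : IsYoungMeasure T Ω (Y ×ˢ Z) μ) (hdμ : IsDisintegration T Ω μhat μ) {r : ℝ}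
    (hr : 0 ≤ r) : HasFiniteMoments T Ω r μ := by
  obtain ⟨κ, hκ, hdis, hae⟩ := h.exists_kernel_ae_eq hμ hdμ
  have hfin := isFiniteMeasure_restrict_prod (T := T) h.isBounded
  have hg : Continuous fun ξ : Val n => √(ξ.1 ^ 2 + ξ.2.1 ^ 2 + ‖ξ.2.2‖ ^ 2) ^ r :=
    Continuous.rpow_const (by fun_prop) fun _ => Or.inr hr
  have hgm : Measurable fun ξ : Val n =>
      ENNReal.ofReal (√(ξ.1 ^ 2 + ξ.2.1 ^ 2 + ‖ξ.2.2‖ ^ 2) ^ r) := hg.measurable.ennreal_ofReal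
  obtain ⟨A, -, hA, -⟩ := h.exists_bound hg
  rw [HasFiniteMoments, restrict_Ioo_prod]
  refine ⟨(hgm.lintegral_kernel (κ := κ)).aemeasurable.congr (hae.mono fun p hp => by simp only [hp]), ?_⟩
  refine lt_of_le_of_lt (lintegral_mono_ae (g := fun _ => ENNReal.ofReal A) ?_) ?_
  · filter_upwards [ae_restrict_mem h.measurableSet_Icc_prod] with p hp
    have := hμ.prob p hp
    have hs : ∀ᵐ ξ ∂μ p, ξ ∈ Y ×ˢ Z := hμ.supp p hp
    refine (lintegral_mono_ae (g := fun _ => ENNReal.ofReal A) (hs.mono fun ξ hξ =>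
      ENNReal.ofReal_le_ofReal ((le_abs_self _).trans (hA ξ hξ)))).trans ?_
    simp
  · rw [lintegral_const]
    exact ENNReal.mul_lt_top ENNReal.ofReal_lt_top (measure_lt_top _ _)

lemma integral_fderiv_mul_moment (h : IsOccupationPair T Ω f y₀ Y Z μhat μb)
    (hμ : IsYoungMeasure T Ω (Y ×ˢ Z) μ) (hdμ : IsDisintegration T Ω μhat μ) {β : ℝ → ℝ}
    (hβ : ContDiff ℝ 1 β) {ψ : TimeSpace n → ℝ} (hψ : ContDiff ℝ ∞ ψ) (hψc : HasCompactSupport ψ)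
    (h0 : ∀ p : TimeSpace n, p.1 = 0 ∨ p.1 = T → ψ p = 0)
    (hlat : β 0 = 0 ∨ ∀ p ∈ cylinderBoundary T Ω, ψ p = 0) (e : TimeSpace n) :
    ∫ p in Icc 0 T ×ˢ Ω, fderiv ℝ ψ p e * (∫ ξ, β ξ.1 ∂μ p) =
      -∫ p in Icc 0 T ×ˢ Ω, ψ p *
        (∫ ξ, (e.1 * ξ.2.1 + inner ℝ e.2 ξ.2.2) * deriv β ξ.1 ∂μ p) := by
  have hβ' := hβ.continuous_deriv le_rfl
  have hβc := hβ.continuous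
  have hψ' : Continuous fun p => fderiv ℝ ψ p e :=
    (hψ.continuous_fderiv (by simp)).clm_apply continuous_const
  rw [← h.integral_mul_eq hμ hdμ (h.integrable_of_continuous hψ') (g := fun ξ => β ξ.1)
    (by fun_prop), h.ibp_direction hβ hψ hψc h0 hlat,
    ← h.integral_mul_eq hμ hdμ (h.integrable_of_continuous hψ.continuous)
    (g := fun ξ => (e.1 * ξ.2.1 + inner ℝ e.2 ξ.2.2) * deriv β ξ.1) (by fun_prop)]

/-- The integration-by-parts formula for the Young measure. -/
lemma satisfiesIBP (h : IsOccupationPair T Ω f y₀ Y Z μhat μb)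
    (hμ : IsYoungMeasure T Ω (Y ×ˢ Z) μ) (hdμ : IsDisintegration T Ω μhat μ) :
    SatisfiesIBP T Ω μ := by
  rintro β hβ ψ ⟨hψ, hψc, hψs⟩
  have hβ' := hβ.continuous_deriv le_rfl
  have hβc := hβ.continuous
  have hψd := hψ.differentiable (by simp)
  have hz : ∀ p ∉ (Ioo 0 T ×ˢ Ω : Set (TimeSpace n)), ψ p = 0 := fun p hp =>
    image_eq_zero_of_notMem_tsupport fun h' => hp (hψs h')
  have h0 : ∀ p : TimeSpace n, p.1 = 0 ∨ p.1 = T → ψ p = 0 := by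
    refine fun p hp => hz p fun h' => ?_
    rcases hp with hp | hp
    · exact h'.1.1.ne' hp
    · exact h'.1.2.ne hp
  have hlat : ∀ p ∈ cylinderBoundary T Ω, ψ p = 0 := by
    refine fun p hp => ?_
    obtain ⟨i, hi⟩ := mem_iUnion.1 hp
    fin_cases i
    · exact h0 p (Or.inl hi.1)
    · exact h0 p (Or.inr hi.1)
    · refine hz p fun h' => ?_
      have := hi.2
      rw [h.isOpen.frontier_eq] at this
      exact this.2 h'.2
  have key := h.integral_fderiv_mul_moment hμ hdμ hβ hψ hψc h0 (Or.inr hlat)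
  rw [restrict_Ioo_prod]
  constructor
  · have := key (1, 0)
    simpa only [timeDeriv_eq_fderiv hψd, one_mul, inner_zero_left, add_zero] using this
  · have i1 : Integrable (fun p => (∫ ξ, β ξ.1 ∂μ p) • spaceGrad ψ p)
        (volume.restrict (Icc 0 T ×ˢ Ω)) := by
      have hb := h.memLp_moment hμ hdμ (g := fun ξ => β ξ.1) (by fun_prop) 2
      have hs : MemLp (spaceGrad ψ) 2 (volume.restrict (Icc 0 T ×ˢ Ω)) := by
        have hfin := isFiniteMeasure_restrict_prod (T := T) h.isBounded
        obtain ⟨B, hB⟩ := (isCompact_closedCylinder (T := T)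
          h.isBounded).exists_bound_of_continuousOn (continuous_spaceGrad hψ).continuousOn
        refine MemLp.of_bound (continuous_spaceGrad hψ).aestronglyMeasurable B ?_
        filter_upwards [ae_restrict_mem h.measurableSet_Icc_prod] with p hp
        exact hB p ⟨hp.1, subset_closure hp.2⟩
      exact memLp_one_iff_integrable.1 (hs.smul hb)
    have i2 : Integrable (fun p => ψ p • (∫ ξ, deriv β ξ.1 • ξ.2.2 ∂μ p))
        (volume.restrict (Icc 0 T ×ˢ Ω)) := by
      have hb := h.memLp_moment hμ hdμ (g := fun ξ => deriv β ξ.1 • ξ.2.2) (by fun_prop) 1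
      obtain ⟨B, hB⟩ := hψc.exists_bound_of_continuous hψ.continuous
      exact (memLp_one_iff_integrable.1 hb).bdd_smul B hψ.continuous.aestronglyMeasurable
        (ae_of_all _ hB)
    refine ext_inner_left ℝ fun e => ?_
    rw [inner_neg_right, ← integral_inner i1, ← integral_inner i2]
    have := key (0, e)
    simp only [zero_mul, zero_add] at this
    convert! this using 1
    · refine integral_congr_ae (ae_of_all _ fun p => ?_)
      simp only
      rw [real_inner_smul_right, real_inner_comm, inner_spaceGrad hψd, mul_comm]
    · congr 1
      refine integral_congr_ae ?_
      filter_upwards [ae_restrict_mem h.measurableSet_Icc_prod] with p hp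
      rw [real_inner_smul_right, ← integral_inner (h.integrable_val hμ hp (by fun_prop))]
      simp only [real_inner_smul_right, mul_comm]

end IsOccupationPair

/-! ### The moments as Lipschitz functions: boundary and initial values -/

/-- The weights `(1 - t/T)^(k+1)` concentrate at `t = 0`. -/
lemma exists_initial_weight {T : ℝ} (hT : 0 < T) (k : ℕ) : ∃ φ : ℝ → ℝ, ContDiff ℝ ∞ φ ∧
    φ 0 = 1 ∧ φ T = 0 ∧ (∫ t in Icc 0 T, deriv φ t) = -1 ∧
    (∫ t in Icc 0 T, |deriv φ t| * t) = T / (k + 2) ∧ (∫ t in Icc 0 T, |φ t|) = T / (k + 2) := by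
  set φ : ℝ → ℝ := fun t => (1 - t / T) ^ (k + 1) with hφ
  set Φ : ℝ → ℝ := fun t => -(T / (k + 2)) * (1 - t / T) ^ (k + 2) with hΦ
  have hs : ContDiff ℝ ∞ φ := by fun_prop
  have hlin : ∀ t : ℝ, HasDerivAt (fun t => 1 - t / T) (-(1 / T)) t := fun t =>
    ((hasDerivAt_id t).div_const T).const_sub 1
  have hd : ∀ t, HasDerivAt φ (deriv φ t) t := fun t => (hs.differentiable (by simp) t).hasDerivAt
  have hdv : ∀ t, deriv φ t = ((k + 1 : ℕ) : ℝ) * (1 - t / T) ^ k * -(1 / T) := fun t =>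
    ((hlin t).pow (k + 1)).deriv
  have hΦd : ∀ t, HasDerivAt Φ (φ t) t := by
    intro t
    have := ((hlin t).pow (k + 2)).const_mul (-(T / (k + 2)))
    refine this.congr_deriv ?_
    simp only [hφ, show k + 2 - 1 = k + 1 from rfl]
    push_cast
    field_simp
  have hdc : Continuous (deriv φ) := hs.continuous_deriv (by simp)
  have h01 : ∀ t ∈ Icc 0 T, 0 ≤ 1 - t / T := fun t ht =>
    sub_nonneg.2 ((div_le_one hT).2 ht.2)
  have hint : ∀ w W : ℝ → ℝ, Continuous w → (∀ t, HasDerivAt W (w t) t) →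
      ∫ t in Icc 0 T, w t = W T - W 0 := by
    intro w W hw hW
    rw [integral_Icc_eq_integral_Ioc, ← intervalIntegral.integral_of_le hT.le,
      intervalIntegral.integral_eq_sub_of_hasDerivAt (fun t _ => hW t)
        (hw.intervalIntegrable _ _)]
  have hφT : φ T = 0 := by simp [hφ, div_self hT.ne']
  have hΦT : Φ T = 0 := by simp [hΦ, div_self hT.ne']
  have hφ0 : φ 0 = 1 := by simp [hφ]
  have hΦ0 : Φ 0 = -(T / (k + 2)) := by simp [hΦ]
  refine ⟨φ, hs, hφ0, hφT, ?_, ?_, ?_⟩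
  · rw [hint _ φ hdc hd, hφT, hφ0]; ring
  · have : ∀ t ∈ Icc 0 T, |deriv φ t| * t = -(deriv φ t * t) := by
      intro t ht
      have hneg : deriv φ t ≤ 0 := by
        rw [hdv]
        exact mul_nonpos_of_nonneg_of_nonpos
          (mul_nonneg (by positivity) (pow_nonneg (h01 t ht) k)) (by simp [hT.le])
      rw [abs_of_nonpos hneg, neg_mul]
    rw [setIntegral_congr_fun measurableSet_Icc this, integral_neg,
      hint (fun t => deriv φ t * t) (fun t => φ t * t - Φ t) (hdc.mul continuous_id) fun t => ?_]
    · simp only [hφT, hφ0, hΦT, hΦ0]; ring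
    · exact (((hd t).mul (hasDerivAt_id t)).sub (hΦd t)).congr_deriv (by simp)
  · have : ∀ t ∈ Icc 0 T, |φ t| = φ t := fun t ht =>
      abs_of_nonneg (pow_nonneg (h01 t ht) _)
    rw [setIntegral_congr_fun measurableSet_Icc this, hint φ Φ hs.continuous hΦd, hΦT, hΦ0]
    ring

namespace IsOccupationPair

variable {n : ℕ} {T : ℝ} {Ω : Set (Space n)} {f : ℝ → Space n → ℝ → ℝ} {y₀ : Space n → ℝ}
  {Y : Set ℝ} {Z : Set (ℝ × Space n)} {μhat μb : Measure (TimeSpace n × Val n)}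
  {μ : TimeSpace n → Measure (Val n)}

lemma restrict_Icc_prod : (volume.restrict (Icc 0 T ×ˢ Ω) : Measure (TimeSpace n)) =
    (volume.restrict (Icc 0 T)).prod (volume.restrict Ω) := by
  rw [Measure.prod_restrict, ← Measure.volume_eq_prod]

lemma integrable_mul_prod {φ : ℝ → ℝ} (hφ : Continuous φ) {v : Space n → ℝ}
    (hv : Integrable v (volume.restrict Ω)) :
    Integrable (fun p : TimeSpace n => φ p.1 * v p.2) (volume.restrict (Icc 0 T ×ˢ Ω)) := by
  rw [restrict_Icc_prod]
  exact (hφ.continuousOn.integrableOn_compact isCompact_Icc : IntegrableOn φ (Icc 0 T)).mul_prod hv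

variable [IsFiniteMeasure μhat] [IsFiniteMeasure μb]

/-- For `β(0) = 0`, the moment `⟨μ, β(y)⟩` is almost everywhere equal to a Lipschitz function of
`(t, x)` which vanishes on the lateral boundary: extended by zero in space, it still has bounded
weak derivatives on `(0, T) × ℝⁿ`, because the boundary terms in the space identities vanish. -/
lemma exists_lipschitz_moment (h : IsOccupationPair T Ω f y₀ Y Z μhat μb)
    (hμ : IsYoungMeasure T Ω (Y ×ˢ Z) μ) (hdμ : IsDisintegration T Ω μhat μ) {β : ℝ → ℝ}
    (hβ : ContDiff ℝ 1 β) (hβ0 : β 0 = 0) :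
    ∃ (M : ℝ≥0) (C : TimeSpace n → ℝ), LipschitzWith M C ∧
      (∀ᵐ p ∂volume.restrict (Icc 0 T ×ˢ Ω), (∫ ξ, β ξ.1 ∂μ p) = C p) ∧
      ∀ t ∈ Ioo 0 T, ∀ x ∈ frontier Ω, C (t, x) = 0 := by
  have hβ' := hβ.continuous_deriv le_rfl
  have hβc := hβ.continuous
  set m : TimeSpace n → ℝ := fun p => ∫ ξ, β ξ.1 ∂μ p with hm
  set u : TimeSpace n → ℝ := (Icc 0 T ×ˢ Ω).indicator m with hu
  set U : Set (TimeSpace n) := Ioo 0 T ×ˢ univ with hU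
  have hUo : IsOpen U := isOpen_Ioo.prod isOpen_univ
  obtain ⟨A, hA0, hA, -⟩ := h.exists_bound
    (g := fun ξ => (|ξ.2.1| + ‖ξ.2.2‖) * |deriv β ξ.1|) (by fun_prop)
  have hmi : Integrable m (volume.restrict (Icc 0 T ×ˢ Ω)) :=
    memLp_one_iff_integrable.1 (h.memLp_moment hμ hdμ (g := fun ξ => β ξ.1) (by fun_prop) 1)
  have hui : Integrable u volume := (integrable_indicator_iff h.measurableSet_Icc_prod).2 hmi
  have : (volume : Measure (TimeSpace n)).IsAddHaarMeasure := by
    rw [Measure.volume_eq_prod]; infer_instance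
  obtain ⟨C, hC, hCu⟩ := exists_lipschitzWith_ae_eq (μ := volume) (M := ⟨A, hA0⟩) hUo
    ((convex_Ioo 0 T).prod convex_univ) hui.locallyIntegrable (by
      rintro ψ ⟨hψ, hψc, hψU⟩ e
      have h0 : ∀ p : TimeSpace n, p.1 = 0 ∨ p.1 = T → ψ p = 0 := by
        refine fun p hp => image_eq_zero_of_notMem_tsupport fun h' => ?_
        have := (hψU h').1
        rcases hp with hp | hp
        · exact this.1.ne' hp
        · exact this.2.ne hp
      have e1 : ∫ p, fderiv ℝ ψ p e * u p = ∫ p in Icc 0 T ×ˢ Ω, fderiv ℝ ψ p e * m p := by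
        rw [← integral_indicator h.measurableSet_Icc_prod]
        refine integral_congr_ae (ae_of_all _ fun p => ?_)
        simp only [hu]
        by_cases hp : p ∈ (Icc 0 T ×ˢ Ω : Set (TimeSpace n)) <;> simp [hp]
      rw [e1, h.integral_fderiv_mul_moment hμ hdμ hβ hψ hψc h0 (Or.inl hβ0) e, abs_neg,
        ← Real.norm_eq_abs]
      have hψi : Integrable (fun p => A * ‖e‖ * |ψ p|) :=
        ((hψ.continuous.integrable_of_hasCompactSupport hψc).abs).const_mul _
      refine (norm_integral_le_of_norm_le hψi.integrableOn ?_).trans ?_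
      · filter_upwards [ae_restrict_mem h.measurableSet_Icc_prod] with p hp
        have := hμ.prob p hp
        have hs : ∀ᵐ ξ ∂μ p, ξ ∈ Y ×ˢ Z := hμ.supp p hp
        rw [norm_mul, mul_comm, Real.norm_eq_abs (ψ p)]
        refine mul_le_mul_of_nonneg_right ?_ (abs_nonneg _)
        have hbd := norm_integral_le_of_norm_le_const (μ := μ p) (C := A * ‖e‖)
          (f := fun ξ => (e.1 * ξ.2.1 + inner ℝ e.2 ξ.2.2) * deriv β ξ.1) (hs.mono fun ξ hξ => by
            have h1 : |e.1 * ξ.2.1 + inner ℝ e.2 ξ.2.2| ≤ (|ξ.2.1| + ‖ξ.2.2‖) * ‖e‖ := by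
              refine (abs_add_le _ _).trans ?_
              rw [abs_mul, add_mul, mul_comm |e.1|]
              refine add_le_add (mul_le_mul_of_nonneg_left (norm_fst_le e) (abs_nonneg _)) ?_
              refine (abs_real_inner_le_norm _ _).trans ?_
              rw [mul_comm]
              exact mul_le_mul_of_nonneg_left (norm_snd_le e) (norm_nonneg _)
            have h2 := (le_abs_self _).trans (hA ξ hξ)
            rw [norm_mul, Real.norm_eq_abs, Real.norm_eq_abs]
            calc |e.1 * ξ.2.1 + inner ℝ e.2 ξ.2.2| * |deriv β ξ.1|
                ≤ (|ξ.2.1| + ‖ξ.2.2‖) * ‖e‖ * |deriv β ξ.1| :=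
                  mul_le_mul_of_nonneg_right h1 (abs_nonneg _)
              _ = (|ξ.2.1| + ‖ξ.2.2‖) * |deriv β ξ.1| * ‖e‖ := by ring
              _ ≤ A * ‖e‖ := mul_le_mul_of_nonneg_right h2 (norm_nonneg _))
        simpa using hbd
      · rw [← integral_const_mul]
        exact setIntegral_le_integral hψi (ae_of_all _ fun p => by positivity))
  refine ⟨_, C, hC, ?_, fun t ht x hx => ?_⟩
  · rw [← restrict_Ioo_prod]
    refine (ae_restrict_iff' (measurableSet_Ioo.prod h.isOpen.measurableSet)).2 ?_
    filter_upwards [hCu] with p hp hpΩ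
    have hpD : p ∈ (Icc 0 T ×ˢ Ω : Set (TimeSpace n)) := ⟨Ioo_subset_Icc_self hpΩ.1, hpΩ.2⟩
    rw [← hp ⟨hpΩ.1, mem_univ _⟩, hu, indicator_of_mem hpD]
  · -- `C` vanishes almost everywhere, hence everywhere, outside of the closure of `Ω`
    have hext : ∀ x ∈ (closure Ω)ᶜ, C (t, x) = 0 := by
      set W : Set (TimeSpace n) := Ioo 0 T ×ˢ (closure Ω)ᶜ with hW
      have hWo : IsOpen W := isOpen_Ioo.prod isClosed_closure.isOpen_compl
      have hae : C =ᵐ[volume.restrict W] fun _ => 0 := by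
        refine (ae_restrict_iff' hWo.measurableSet).2 ?_
        filter_upwards [hCu] with p hp hpW
        rw [← hp ⟨hpW.1, mem_univ _⟩, hu,
          indicator_of_notMem fun hp' => hpW.2 (subset_closure hp'.2)]
      have := Measure.eqOn_open_of_ae_eq hae hWo hC.continuous.continuousOn continuousOn_const
      exact fun x hx => this ⟨ht, hx⟩
    have hcl : IsClosed {x : Space n | C (t, x) = 0} :=
      isClosed_eq (hC.continuous.comp (by fun_prop)) continuous_const
    exact closure_minimal hext hcl (h.lipschitz.frontier_subset h.isOpen hx)

/-- The initial value of the continuous representative `C` of the moment `⟨μ, β(y)⟩`: test the time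
identity with functions of `t` that concentrate at `t = 0`. -/
lemma initial_value (h : IsOccupationPair T Ω f y₀ Y Z μhat μb)
    (hμ : IsYoungMeasure T Ω (Y ×ˢ Z) μ) (hdμ : IsDisintegration T Ω μhat μ) {β : ℝ → ℝ}
    (hβ : ContDiff ℝ 1 β) (hβy : Integrable (fun x => β (y₀ x)) (volume.restrict Ω))
    {M : ℝ≥0} {C : TimeSpace n → ℝ} (hC : LipschitzWith M C)
    (hCm : ∀ᵐ p ∂volume.restrict (Icc 0 T ×ˢ Ω), (∫ ξ, β ξ.1 ∂μ p) = C p) :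
    ∀ᵐ x ∂volume.restrict Ω, C (0, x) = β (y₀ x) := by
  have hβ' := hβ.continuous_deriv le_rfl
  have hβc := hβ.continuous
  have hCc := hC.continuous
  have hΩfin : IsFiniteMeasure (volume.restrict Ω) :=
    ⟨by rw [Measure.restrict_apply_univ]; exact h.isBounded.measure_lt_top⟩
  have hC0 : Integrable (fun x => C (0, x)) (volume.restrict Ω) :=
    memLp_one_iff_integrable.1 (memLp_of_continuous_of_isBounded h.isBounded
      h.isOpen.measurableSet (by fun_prop) 1)
  obtain ⟨B, hB0, hB, -⟩ := h.exists_bound (g := fun ξ => ξ.2.1 * deriv β ξ.1) (by fun_prop)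
  have hloc : LocallyIntegrableOn (fun x => C (0, x) - β (y₀ x)) Ω :=
    IntegrableOn.locallyIntegrableOn (hC0.sub hβy)
  have hzero := h.isOpen.ae_eq_zero_of_integral_contDiff_smul_eq_zero hloc (by
    intro v hv hvc hvΩ
    have hv0 : ∀ x ∉ Ω, v x = 0 := fun x hx =>
      image_eq_zero_of_notMem_tsupport fun h' => hx (hvΩ h')
    rw [← setIntegral_eq_integral_of_forall_compl_eq_zero (s := Ω)
      fun x hx => by rw [hv0 x hx, zero_smul]]
    simp only [smul_eq_mul]
    have hvi : Integrable v (volume.restrict Ω) :=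
      (hv.continuous.integrable_of_hasCompactSupport hvc).integrableOn
    obtain ⟨b, hb⟩ := hvc.exists_bound_of_continuous hv.continuous
    have i1 : Integrable (fun x => v x * C (0, x)) (volume.restrict Ω) :=
      hC0.bdd_mul hv.continuous.aestronglyMeasurable (ae_of_all _ hb)
    have i2 : Integrable (fun x => v x * β (y₀ x)) (volume.restrict Ω) :=
      hβy.bdd_mul hv.continuous.aestronglyMeasurable (ae_of_all _ hb)
    set I := ∫ x in Ω, |v x|
    set S := ∫ x in Ω, v x * (C (0, x) - β (y₀ x)) with hS
    have key : ∀ k : ℕ, |S| ≤ (M + B) * I * T * (1 / ((k : ℝ) + 1)) := by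
      intro k
      obtain ⟨φ, hφ, hφ0, hφT, J1, J2, J3⟩ := exists_initial_weight h.pos k
      have hφ' : Continuous (deriv φ) := hφ.continuous_deriv (by simp)
      have hφc := hφ.continuous
      have hvc' := hv.continuous
      have hid := h.identities.ibp_time φ v _ β hφ
        (memH1WithTrace_of_contDiff h.isOpen h.isBounded hv) hβ
      have j1 : Integrable (fun p : TimeSpace n => deriv φ p.1 * v p.2)
        (volume.restrict (Icc 0 T ×ˢ Ω)) := integrable_mul_prod hφ' hvi
      have j2 : Integrable (fun p : TimeSpace n => φ p.1 * v p.2)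
        (volume.restrict (Icc 0 T ×ˢ Ω)) := integrable_mul_prod hφc hvi
      have hb1 : Integrable (fun q : TimeSpace n × Val n => φ q.1.1 * v q.1.2 * β q.2.1) μb :=
        h.integrable_boundary (F := fun p => φ p.1 * v p.2) (by fun_prop) (g := fun ξ => β ξ.1)
          (by fun_prop)
      have hsplit : ∫ q, (deriv φ q.1.1 * v q.1.2 * β q.2.1
          + q.2.2.1 * (φ q.1.1 * v q.1.2 * deriv β q.2.1)) ∂μhat =
          (∫ p in Icc 0 T ×ˢ Ω, deriv φ p.1 * v p.2 * C p) +
          ∫ p in Icc 0 T ×ˢ Ω, φ p.1 * v p.2 * ∫ ξ, ξ.2.1 * deriv β ξ.1 ∂μ p := by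
        have s1 := h.integrable_mul_val j1 (g := fun ξ => β ξ.1) (by fun_prop)
        have s2 := h.integrable_mul_val j2 (g := fun ξ => ξ.2.1 * deriv β ξ.1) (by fun_prop)
        have e1 := h.integral_mul_eq hμ hdμ j1 (g := fun ξ => β ξ.1) (by fun_prop)
        have e2 := h.integral_mul_eq hμ hdμ j2 (g := fun ξ => ξ.2.1 * deriv β ξ.1) (by fun_prop)
        rw [← e2, integral_congr_ae (hCm.mono fun p hp => congrArg (deriv φ p.1 * v p.2 * ·) hp.symm), ← e1,
          ← integral_add s1 s2]
        refine integral_congr_ae (ae_of_all _ fun q => ?_)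
        simp only
        ring
      rw [integral_mul_normalTime h.pos (h.ae_mem_boundary.mono fun q hq => hq.1) hb1,
        h.identities.initial φ v _ β hφ
          (memH1WithTrace_of_contDiff h.isOpen h.isBounded hv) hβ,
        setIntegral_eq_zero_of_forall_eq_zero (t := boundaryPiece T Ω 1 ×ˢ univ) (fun q hq => by
          have : q.1.1 = T := hq.1.1
          rw [this, hφT, zero_mul, zero_mul]), hsplit, hφ0] at hid
      simp only [one_mul, zero_sub, sub_neg_eq_add] at hid
      have hprod : ∫ p in Icc 0 T ×ˢ Ω, deriv φ p.1 * (v p.2 * C (0, p.2)) =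
          -∫ x in Ω, v x * C (0, x) := by
        rw [restrict_Icc_prod, integral_prod_mul (deriv φ) (fun x => v x * C (0, x)), J1]
        ring
      have j3 : Integrable (fun p : TimeSpace n => deriv φ p.1 * (v p.2 * C (0, p.2)))
        (volume.restrict (Icc 0 T ×ˢ Ω)) := integrable_mul_prod hφ' i1
      have j4 : Integrable (fun p : TimeSpace n => deriv φ p.1 * v p.2 * C p)
          (volume.restrict (Icc 0 T ×ˢ Ω)) :=
        h.integrable_of_continuous (by fun_prop)
      have b1 : |∫ p in Icc 0 T ×ˢ Ω, (deriv φ p.1 * v p.2 * C p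
          - deriv φ p.1 * (v p.2 * C (0, p.2)))| ≤ T / (k + 2) * (M * I) := by
        have hR : Integrable (fun p : TimeSpace n => |deriv φ p.1| * p.1 * (M * |v p.2|))
            (volume.restrict (Icc 0 T ×ˢ Ω)) := by
          exact h.integrable_of_continuous (by fun_prop)
        rw [← Real.norm_eq_abs]
        refine (norm_integral_le_of_norm_le hR ?_).trans (le_of_eq ?_)
        · filter_upwards [ae_restrict_mem h.measurableSet_Icc_prod] with p hp
          have e1 : deriv φ p.1 * v p.2 * C p - deriv φ p.1 * (v p.2 * C (0, p.2)) =
            deriv φ p.1 * v p.2 * (C p - C (0, p.2)) := by ring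
          have e2 : ‖C p - C (0, p.2)‖ ≤ M * p.1 := by
            have := hC.dist_le_mul p (0, p.2)
            rwa [Prod.dist_eq, dist_self, Real.dist_eq, Real.dist_eq, sub_zero,
              abs_of_nonneg hp.1.1, max_eq_left hp.1.1] at this
          rw [e1, norm_mul, norm_mul]
          calc ‖deriv φ p.1‖ * ‖v p.2‖ * ‖C p - C (0, p.2)‖
              ≤ ‖deriv φ p.1‖ * ‖v p.2‖ * (M * p.1) :=
                mul_le_mul_of_nonneg_left e2 (by positivity)
            _ = |deriv φ p.1| * p.1 * (M * |v p.2|) := by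
                rw [Real.norm_eq_abs, Real.norm_eq_abs]; ring
        · rw [restrict_Icc_prod, integral_prod_mul (fun t => |deriv φ t| * t)
            (fun x => M * |v x|), J2, integral_const_mul]
      have b2 : |∫ p in Icc 0 T ×ˢ Ω, φ p.1 * v p.2 * ∫ ξ, ξ.2.1 * deriv β ξ.1 ∂μ p| ≤
          T / (k + 2) * (B * I) := by
        have hR : Integrable (fun p : TimeSpace n => |φ p.1| * (B * |v p.2|))
            (volume.restrict (Icc 0 T ×ˢ Ω)) := by
          exact h.integrable_of_continuous (by fun_prop)
        rw [← Real.norm_eq_abs]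
        refine (norm_integral_le_of_norm_le hR ?_).trans (le_of_eq ?_)
        · filter_upwards [ae_restrict_mem h.measurableSet_Icc_prod] with p hp
          have := hμ.prob p hp
          have hs : ∀ᵐ ξ ∂μ p, ξ ∈ Y ×ˢ Z := hμ.supp p hp
          have e2 : ‖∫ ξ, ξ.2.1 * deriv β ξ.1 ∂μ p‖ ≤ B := by
            simpa using norm_integral_le_of_norm_le_const (f := fun ξ => ξ.2.1 * deriv β ξ.1)
              (hs.mono hB)
          rw [norm_mul, norm_mul, Real.norm_eq_abs (φ p.1), Real.norm_eq_abs (v p.2)]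
          calc |φ p.1| * |v p.2| * ‖∫ ξ, ξ.2.1 * deriv β ξ.1 ∂μ p‖
              ≤ |φ p.1| * |v p.2| * B := mul_le_mul_of_nonneg_left e2 (by positivity)
            _ = |φ p.1| * (B * |v p.2|) := by ring
        · rw [restrict_Icc_prod, integral_prod_mul (fun t => |φ t|)
            (fun x => B * |v x|), J3, integral_const_mul]
      rw [integral_sub j4 j3, hprod, sub_neg_eq_add] at b1
      have hSeq : S = (∫ x in Ω, v x * C (0, x)) - ∫ x in Ω, v x * β (y₀ x) := by
        rw [hS, ← integral_sub i1 i2]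
        simp only [mul_sub]
      have hIn : 0 ≤ I := integral_nonneg fun x => abs_nonneg _
      have b3 : T / ((k : ℝ) + 2) ≤ T * (1 / ((k : ℝ) + 1)) := by
        rw [mul_one_div]
        exact div_le_div_of_nonneg_left h.pos.le (by positivity) (by linarith)
      have b4 : |S| ≤ T / ((k : ℝ) + 2) * ((M + B) * I) := by
        have b1' := abs_le.1 b1
        have b2' := abs_le.1 b2
        rw [abs_le, hSeq]
        constructor <;> nlinarith
      calc |S| ≤ T / ((k : ℝ) + 2) * ((M + B) * I) := b4
        _ ≤ T * (1 / ((k : ℝ) + 1)) * ((M + B) * I) :=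
          mul_le_mul_of_nonneg_right b3 (mul_nonneg (add_nonneg M.2 hB0) hIn)
        _ = (M + B) * I * T * (1 / ((k : ℝ) + 1)) := by ring
    have hlim := (tendsto_one_div_add_atTop_nhds_zero_nat (𝕜 := ℝ)).const_mul ((M + B) * I * T)
    rw [mul_zero] at hlim
    exact abs_nonpos_iff.1 (ge_of_tendsto' hlim key))
  refine (ae_restrict_iff' h.isOpen.measurableSet).2 ?_
  filter_upwards [hzero] with x hx hxΩ
  exact sub_eq_zero.1 (hx hxΩ)

end IsOccupationPair

/-! ### Moment equations and energy dissipation -/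

namespace IsOccupationPair

variable {n : ℕ} {T : ℝ} {Ω : Set (Space n)} {f : ℝ → Space n → ℝ → ℝ} {y₀ : Space n → ℝ}
  {Y : Set ℝ} {Z : Set (ℝ × Space n)} {μhat μb : Measure (TimeSpace n × Val n)}
  {μ : TimeSpace n → Measure (Val n)} [IsFiniteMeasure μhat] [IsFiniteMeasure μb]

lemma reaction_aestronglyMeasurable (h : IsOccupationPair T Ω f y₀ Y Z μhat μb) :
    AEStronglyMeasurable (fun q : TimeSpace n × Val n => f q.1.1 q.1.2 q.2.1) μhat := by
  obtain ⟨F, hF, hfF⟩ := h.reaction.exists_measurable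
  have hm : Measurable fun q : TimeSpace n × Val n => F (q.2.1, q.1) := by fun_prop
  exact hm.aestronglyMeasurable.congr ((h.ae_of_ae_fst hfF).mono fun q hq => (hq _).symm)

lemma exists_reaction_bound (h : IsOccupationPair T Ω f y₀ Y Z μhat μb) :
    ∃ B, 0 ≤ B ∧ ∀ᵐ q ∂μhat, |f q.1.1 q.1.2 q.2.1| ≤ B := by
  obtain ⟨B, hB0, hB⟩ := h.reaction.bounded Y h.compact_Y
  refine ⟨B, hB0, ?_⟩
  filter_upwards [h.ae_of_ae_fst hB, h.ae_mem] with q hq hm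
  exact hq _ hm.2.1

lemma integrable_mul_reaction (h : IsOccupationPair T Ω f y₀ Y Z μhat μb) {F : TimeSpace n → ℝ}
    (hF : Integrable F (volume.restrict (Icc 0 T ×ˢ Ω))) {g : Val n → ℝ} (hg : Continuous g) :
    Integrable (fun q => F q.1 * (g q.2 * f q.1.1 q.1.2 q.2.1)) μhat := by
  obtain ⟨B, hB0, hB⟩ := h.exists_reaction_bound
  obtain ⟨A, hA0, -, hA, -⟩ := h.exists_bound hg
  refine h.integrable_mul hF ((aestronglyMeasurable_val hg).mul h.reaction_aestronglyMeasurable)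
    (A := A * B) ?_
  filter_upwards [hA, hB] with q h1 h2
  rw [abs_mul]
  exact mul_le_mul h1 h2 (abs_nonneg _) hA0

/-- The dissipation identity for the Young measure. -/
lemma dissipation (h : IsOccupationPair T Ω f y₀ Y Z μhat μb)
    (hμ : IsYoungMeasure T Ω (Y ×ˢ Z) μ) (hdμ : IsDisintegration T Ω μhat μ) {φ : ℝ → ℝ}
    (hφ : IsTestFunction (Ioo 0 T) φ) :
    (∫ p in Ioo 0 T ×ˢ Ω, (φ p.1 * (∫ ξ, ξ.2.1 ^ 2 ∂μ p)
      - deriv φ p.1 * (∫ ξ, (1 / 2 : ℝ) * ‖ξ.2.2‖ ^ 2 ∂μ p)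
      - φ p.1 * (∫ ξ, ξ.2.1 * f p.1 p.2 ξ.1 ∂μ p))) = 0 := by
  obtain ⟨hφs, hφc, hφT⟩ := hφ
  have hφ' : Continuous (deriv φ) := hφs.continuous_deriv (by simp)
  have hφcont := hφs.continuous
  have h0 : ∀ t, t = 0 ∨ t = T → φ t = 0 := by
    refine fun t ht => image_eq_zero_of_notMem_tsupport fun h' => ?_
    rcases ht with ht | ht
    · exact (hφT h').1.ne' ht
    · exact (hφT h').2.ne ht
  have key := h.identities.dissipation φ hφs
  have hb : ∫ q, (1 / 2 : ℝ) * φ q.1.1 * ‖q.2.2.2‖ ^ 2 * normalTime T q.1 ∂μb = 0 := by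
    refine integral_eq_zero_of_ae (ae_of_all _ fun q => ?_)
    by_cases hq : q.1.1 = 0 ∨ q.1.1 = T
    · simp [h0 _ hq]
    · rw [not_or] at hq
      simp [normalTime, hq.1, hq.2]
  have iφ : Integrable (fun p : TimeSpace n => φ p.1) (volume.restrict (Icc 0 T ×ˢ Ω)) :=
    h.integrable_of_continuous (by fun_prop)
  have iφ' : Integrable (fun p : TimeSpace n => deriv φ p.1) (volume.restrict (Icc 0 T ×ˢ Ω)) :=
    h.integrable_of_continuous (by fun_prop)
  have e1 := h.integrable_mul_val iφ (g := fun ξ => ξ.2.1 ^ 2) (by fun_prop)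
  have e2 := h.integrable_mul_val iφ' (g := fun ξ => (1 / 2 : ℝ) * ‖ξ.2.2‖ ^ 2) (by fun_prop)
  have e3 := h.integrable_mul_reaction iφ (g := fun ξ => ξ.2.1) (by fun_prop)
  have e4 := (e1.sub e2).sub e3
  rw [hb, add_zero] at key
  rw [restrict_Ioo_prod]
  have hpush := h.integral_eq hμ hdμ e4
  refine Eq.trans ?_ (hpush.symm.trans (Eq.trans ?_ key))
  · refine integral_congr_ae ?_
    filter_upwards [ae_restrict_mem h.measurableSet_Icc_prod, h.reaction.continuous] with p hp hc
    have k1 : Integrable (fun ξ : Val n => φ p.1 * ξ.2.1 ^ 2) (μ p) :=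
      h.integrable_val hμ hp (by fun_prop)
    have k2 : Integrable (fun ξ : Val n => deriv φ p.1 * ((1 / 2 : ℝ) * ‖ξ.2.2‖ ^ 2)) (μ p) :=
      h.integrable_val hμ hp (by fun_prop)
    have k3 : Integrable (fun ξ : Val n => φ p.1 * (ξ.2.1 * f p.1 p.2 ξ.1)) (μ p) :=
      h.integrable_val hμ hp (by fun_prop)
    have k4 := integral_sub (k1.sub k2) k3
    have k5 := integral_sub k1 k2
    simp only [Pi.sub_apply] at k4 ⊢
    rw [k4, k5]
    simp only [integral_const_mul]
  · refine integral_congr_ae (ae_of_all _ fun q => ?_)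
    simp only [Pi.sub_apply]
    ring

/-- The weak form of the equation for the moment `⟨μ, β(y)⟩`, whose derivatives are the moments of
`z₀ β'(y)` and `β'(y) z̄`, with `γ = β'`. The lateral boundary term vanishes because functions of
`W₀^{1,2}` have zero trace. -/
lemma moment_weak_form (h : IsOccupationPair T Ω f y₀ Y Z μhat μb)
    (hμ : IsYoungMeasure T Ω (Y ×ˢ Z) μ) (hdμ : IsDisintegration T Ω μhat μ) {γ : ℝ → ℝ}
    (hγ : ContDiff ℝ 1 γ) {v : Space n → ℝ} {g : Space n → Space n} (hv : MemW10 Ω 2 v g)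
    {φ : ℝ → ℝ} (hφ : ContDiff ℝ ∞ φ) :
    ∫ p in Ioo 0 T ×ˢ Ω, φ p.1 * (v p.2 * (∫ ξ, ξ.2.1 * γ ξ.1 ∂μ p)
      + inner ℝ (g p.2) (∫ ξ, γ ξ.1 • ξ.2.2 ∂μ p)
      - v p.2 * ((∫ ξ, γ ξ.1 * f p.1 p.2 ξ.1 ∂μ p) - ∫ ξ, deriv γ ξ.1 * ‖ξ.2.2‖ ^ 2 ∂μ p)) = 0 := by
  have hγc := hγ.continuous
  have hγ' := hγ.continuous_deriv le_rfl
  have hφc := hφ.continuous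
  have hΩfin : IsFiniteMeasure (volume.restrict Ω) :=
    ⟨by rw [Measure.restrict_apply_univ]; exact h.isBounded.measure_lt_top⟩
  set w := Ω.indicator v with hw
  have hwt : MemH1WithTrace Ω w g := hv.memH1WithTrace_indicator h.isOpen
  have hwi : Integrable w (volume.restrict Ω) := hwt.1.1.integrable (by norm_num)
  have hgi : Integrable g (volume.restrict Ω) := hwt.1.2.1.integrable (by norm_num)
  have hgj : ∀ j, Integrable (fun x => g x j) (volume.restrict Ω) := fun j =>
    (EuclideanSpace.proj (𝕜 := ℝ) j).integrable_comp hgi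
  have key := h.identities.weak_form φ w g γ hφ hwt hγ
  have hb : ∀ j, ∫ q, φ q.1.1 * w q.1.2 * γ q.2.1 * q.2.2.2 j * normalSpace T Ω q.1 j ∂μb = 0 := by
    intro j
    refine integral_eq_zero_of_ae ?_
    filter_upwards [h.ae_mem_boundary] with q hq
    by_cases hend : q.1.1 = 0 ∨ q.1.1 = T
    · simp [normalSpace, hend]
    · obtain ⟨i, hi⟩ := mem_iUnion.1 hq.1
      have hfr : q.1.2 ∈ frontier Ω := by
        fin_cases i
        · exact absurd (Or.inl hi.1) hend
        · exact absurd (Or.inr hi.1) hend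
        · exact hi.2
      rw [h.isOpen.frontier_eq] at hfr
      rw [hw, indicator_of_notMem hfr.2]
      simp
  simp only [hb, Finset.sum_const_zero, sub_zero] at key
  have iw : Integrable (fun p : TimeSpace n => φ p.1 * w p.2) (volume.restrict (Icc 0 T ×ˢ Ω)) :=
    integrable_mul_prod hφc hwi
  have ig : ∀ j, Integrable (fun p : TimeSpace n => φ p.1 * g p.2 j)
      (volume.restrict (Icc 0 T ×ˢ Ω)) := fun j => integrable_mul_prod hφc (hgj j)
  have a1 := h.integrable_mul_val iw (g := fun ξ => ξ.2.1 * γ ξ.1) (by fun_prop)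
  have a2 := h.integrable_mul_reaction iw (g := fun ξ => γ ξ.1) (by fun_prop)
  have a3 := h.integrable_mul_val iw (g := fun ξ => deriv γ ξ.1 * ‖ξ.2.2‖ ^ 2) (by fun_prop)
  have a4 := integrable_finsetSum Finset.univ fun j _ =>
    h.integrable_mul_val (ig j) (g := fun ξ => γ ξ.1 * ξ.2.2 j) (by fun_prop)
  have a5 := ((a1.sub a2).add a3).add a4
  rw [restrict_Ioo_prod]
  have hpush := h.integral_eq hμ hdμ a5
  refine Eq.trans ?_ (hpush.symm.trans (Eq.trans ?_ key))
  · refine integral_congr_ae ?_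
    filter_upwards [ae_restrict_mem h.measurableSet_Icc_prod, h.reaction.continuous] with p hp hc
    have hwv : w p.2 = v p.2 := indicator_of_mem hp.2 v
    have k1 : Integrable (fun ξ : Val n => φ p.1 * w p.2 * (ξ.2.1 * γ ξ.1)) (μ p) :=
      h.integrable_val hμ hp (by fun_prop)
    have k2 : Integrable (fun ξ : Val n => φ p.1 * w p.2 * (γ ξ.1 * f p.1 p.2 ξ.1)) (μ p) :=
      h.integrable_val hμ hp (by fun_prop)
    have k3 : Integrable (fun ξ : Val n => φ p.1 * w p.2 * (deriv γ ξ.1 * ‖ξ.2.2‖ ^ 2)) (μ p) :=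
      h.integrable_val hμ hp (by fun_prop)
    have k4 : Integrable (fun ξ : Val n => ∑ j, φ p.1 * g p.2 j * (γ ξ.1 * ξ.2.2 j)) (μ p) :=
      h.integrable_val hμ hp (by fun_prop)
    have hin : ∫ ξ, ∑ j, φ p.1 * g p.2 j * (γ ξ.1 * ξ.2.2 j) ∂μ p =
        φ p.1 * inner ℝ (g p.2) (∫ ξ, γ ξ.1 • ξ.2.2 ∂μ p) := by
      rw [← integral_inner (h.integrable_val hμ hp (by fun_prop)), ← integral_const_mul]
      refine integral_congr_ae (ae_of_all _ fun ξ => ?_)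
      simp only [PiLp.inner_apply, RCLike.inner_apply, conj_trivial, Finset.mul_sum,
        PiLp.smul_apply, smul_eq_mul]
      exact Finset.sum_congr rfl fun j _ => by ring
    have s1 := integral_sub k1 k2
    have s2 := integral_add (k1.sub k2) k3
    have s3 := integral_add ((k1.sub k2).add k3) k4
    simp only [Pi.sub_apply, Pi.add_apply] at s2 s3 ⊢
    rw [s3, s2, s1, hin, integral_const_mul, integral_const_mul, integral_const_mul, hwv]
    ring
  · refine integral_congr_ae (ae_of_all _ fun q => ?_)
    simp only [Pi.sub_apply, Pi.add_apply, EuclideanSpace.real_norm_sq_eq, Finset.mul_sum]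
    rw [add_assoc, ← Finset.sum_add_distrib]
    congr 1
    · ring
    · exact Finset.sum_congr rfl fun j _ => by ring

/-- The moment equation for `⟨μ, β(y)⟩`, where `β(0) = 0`. -/
lemma solvesMomentEquation (h : IsOccupationPair T Ω f y₀ Y Z μhat μb)
    (hμ : IsYoungMeasure T Ω (Y ×ˢ Z) μ) (hdμ : IsDisintegration T Ω μhat μ) {β : ℝ → ℝ}
    (hβ : ContDiff ℝ 2 β) (hβ0 : β 0 = 0)
    (hβy : Integrable (fun x => β (y₀ x)) (volume.restrict Ω)) (r : ℝ) :
    SolvesMomentEquation T Ω r (fun p => ∫ ξ, β ξ.1 ∂μ p)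
      (fun p => (∫ ξ, deriv β ξ.1 * f p.1 p.2 ξ.1 ∂μ p) -
        ∫ ξ, deriv (deriv β) ξ.1 * ‖ξ.2.2‖ ^ 2 ∂μ p) (fun x => β (y₀ x)) := by
  have hβ1 : ContDiff ℝ 1 β := hβ.of_le (by norm_num)
  have hγ : ContDiff ℝ 1 (deriv β) := (contDiff_succ_iff_deriv (n := 1)).1 hβ |>.2.2
  have hβc := hβ.continuous
  have hγc := hγ.continuous
  obtain ⟨M, C, hC, hCm, hCfr⟩ := h.exists_lipschitz_moment hμ hdμ hβ1 hβ0
  have hCc := hC.continuous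
  have hslice : ∀ᵐ t ∂volume.restrict (Icc 0 T), ∀ᵐ x ∂volume.restrict Ω,
      C (t, x) = ∫ ξ, β ξ.1 ∂μ (t, x) := by
    rw [restrict_Icc_prod] at hCm
    exact (Measure.ae_ae_of_ae_prod hCm).mono fun t ht => ht.mono fun x hx => hx.symm
  refine ⟨⟨fun p => ∫ ξ, ξ.2.1 * deriv β ξ.1 ∂μ p, fun p => ∫ ξ, deriv β ξ.1 • ξ.2.2 ∂μ p,
    ⟨?_, ?_, ?_, fun ψ hψ => h.satisfiesIBP hμ hdμ β hβ1 ψ hψ⟩, fun v g hv φ hφ =>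
      h.moment_weak_form hμ hdμ hγ hv hφ.1⟩, ?_, fun t x => C (t, x), fun t _ => ?_, fun t _ => ?_,
    hslice, h.initial_value hμ hdμ hβ1 hβy hC hCm⟩
  · rw [restrict_Ioo_prod]
    exact h.memLp_moment hμ hdμ (g := fun ξ => β ξ.1) (by fun_prop) _
  · rw [restrict_Ioo_prod]
    exact h.memLp_moment hμ hdμ (g := fun ξ => ξ.2.1 * deriv β ξ.1) (by fun_prop) _
  · rw [restrict_Ioo_prod]
    exact h.memLp_moment hμ hdμ (g := fun ξ => deriv β ξ.1 • ξ.2.2) (by fun_prop) _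
  · have hIoo : ∀ᵐ t ∂volume.restrict (Icc 0 T), t ∈ Ioo 0 T := by
      rw [← Measure.restrict_congr_set (Ioo_ae_eq_Icc (μ := volume) (a := (0 : ℝ)) (b := T))]
      exact ae_restrict_mem measurableSet_Ioo
    filter_upwards [hslice, hIoo] with t ht htT
    exact ⟨fun x => C (t, x), (by fun_prop : Continuous fun x => C (t, x)).continuousOn, ht,
      hCfr t htT⟩
  · exact memLp_of_continuous_of_isBounded h.isBounded h.isOpen.measurableSet (by fun_prop) _
  · -- the representative is Lipschitz in `t`, uniformly in `x`
    have hbd : ∀ t', eLpNorm (fun x => C (t', x) - C (t, x)) (ENNReal.ofReal r)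
        (volume.restrict Ω) ≤ eLpNorm (fun _ : Space n => (1 : ℝ)) (ENNReal.ofReal r)
          (volume.restrict Ω) * ENNReal.ofReal (M * |t' - t|) := by
      intro t'
      rw [mul_comm]
      refine eLpNorm_le_mul_eLpNorm_of_ae_le_mul (ae_of_all _ fun x => ?_) _
      have := hC.dist_le_mul (t', x) (t, x)
      rwa [Prod.dist_eq, dist_self, max_eq_left dist_nonneg, Real.dist_eq, Real.dist_eq,
        ← Real.norm_eq_abs, ← mul_one (_ * _), ← norm_one (α := ℝ)] at this
    have hΩfin : IsFiniteMeasure (volume.restrict Ω) :=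
      ⟨by rw [Measure.restrict_apply_univ]; exact h.isBounded.measure_lt_top⟩
    have hone : eLpNorm (fun _ : Space n => (1 : ℝ)) (ENNReal.ofReal r) (volume.restrict Ω) ≠ ⊤ :=
      (memLp_const (1 : ℝ)).2.ne
    have hlim : Tendsto (fun t' : ℝ => eLpNorm (fun _ : Space n => (1 : ℝ)) (ENNReal.ofReal r)
        (volume.restrict Ω) * ENNReal.ofReal (M * |t' - t|)) (𝓝 t) (𝓝 0) := by
      have h1 : Continuous fun t' : ℝ => ENNReal.ofReal (M * |t' - t|) :=
        ENNReal.continuous_ofReal.comp (by fun_prop)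
      have h2 := ENNReal.Tendsto.const_mul (h1.tendsto t) (Or.inr hone)
      simpa using h2
    exact (tendsto_of_tendsto_of_tendsto_of_le_of_le tendsto_const_nhds hlim (fun _ => bot_le)
      hbd).mono_left nhdsWithin_le_nhds

end IsOccupationPair

theorem proposition6p1 (n : ℕ) (hn : 1 ≤ n) (T : ℝ) (hT : 0 < T)
    (Ω : Set (Space n)) (hΩ_open : IsOpen Ω) (hΩ_bdd : Bornology.IsBounded Ω)
    (hΩ_lip : HasLipschitzBoundary Ω)
    (r : ℝ) (hr2 : 2 ≤ r) (hrn : (n : ℝ) < r)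
    (f : ℝ → Space n → ℝ → ℝ) (hf : IsReactionTerm T Ω f)
    (y₀ : Space n → ℝ) (hy₀ : ∃ g, MemW10 Ω (ENNReal.ofReal r) y₀ g)
    (Y : Set ℝ) (hY : IsCompact Y) (Z : Set (ℝ × Space n)) (hZ : IsCompact Z)
    (μhat μhatb : Measure (TimeSpace n × Val n))
    [IsFiniteMeasure μhat] [IsFiniteMeasure μhatb]
    (hμ_supp : μhat (closedCylinder T Ω ×ˢ (Y ×ˢ Z))ᶜ = 0)
    (hμb_supp : μhatb (cylinderBoundary T Ω ×ˢ (Y ×ˢ Z))ᶜ = 0)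
    (hid : OccupationIdentities T Ω f y₀ μhat μhatb) :
    (∃ μ, IsYoungMeasure T Ω (Y ×ˢ Z) μ ∧ IsDisintegration T Ω μhat μ) ∧
    ∀ μ, IsYoungMeasure T Ω (Y ×ˢ Z) μ → IsDisintegration T Ω μhat μ →
      IsEmvSolution T Ω r f y₀ Y Z μ := by
  have h : IsOccupationPair T Ω f y₀ Y Z μhat μhatb :=
    ⟨hT, hΩ_open, hΩ_bdd, hΩ_lip, hf, hY, hZ, hμ_supp, hμb_supp, hid⟩
  have hΩfin : IsFiniteMeasure (volume.restrict Ω) :=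
    ⟨by rw [Measure.restrict_apply_univ]; exact hΩ_bdd.measure_lt_top⟩
  obtain ⟨g, ⟨hy₀r, -, -⟩, -⟩ := hy₀
  have hy₀2 : MemLp y₀ 2 (volume.restrict Ω) := hy₀r.mono_exponent (by
    rw [← ENNReal.ofReal_ofNat]; exact ENNReal.ofReal_le_ofReal hr2)
  refine ⟨h.exists_youngMeasure, fun μ hμ hdμ => ⟨hμ, h.hasFiniteMoments hμ hdμ (by linarith),
    h.satisfiesIBP hμ hdμ, ?_, ?_, fun φ hφ => h.dissipation hμ hdμ hφ⟩⟩
  · have := h.solvesMomentEquation hμ hdμ (β := fun y => y) contDiff_id rfl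
      (hy₀2.integrable (by norm_num)) r
    simpa using this
  · have := h.solvesMomentEquation hμ hdμ (β := fun y => y ^ 2) (contDiff_id.pow 2) (by simp)
      hy₀2.integrable_sq r
    have hd : deriv (fun y : ℝ => y ^ 2) = fun y => 2 * y := by funext y; simp
    have hdd : deriv (fun y : ℝ => 2 * y) = fun _ => 2 := by
      funext y; simp
    simpa only [hd, hdd, mul_assoc, integral_const_mul] using this
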